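/- Let $\pi:E\to M$ be a smooth fibred manifold with $\dim M=m>1$ (for example a fibre bundle), $\eta$ a volume form on $M$, and $J^1\pi$ the first jet bundle, with $\omega$ the pull-back of $\eta$ to $J^1\pi$ and local coordinates $(x^\alpha,y^A,v^A_\alpha)$ such that $\omega=dx^1\wedge\dots\wedge dx^m$. Let $\mathcal L=L\,\omega$ be a Lagrangian density with $L\in C^\infty(J^1\pi)$, let $\mathcal V$ be the vertical endomorphism of $J^1\pi$ (locally $\mathcal V=(dy^A-v^A_\alpha dx^\alpha)\wedge i(\partial/\partial x^\nu)\omega\otimes\partial/\partial v^A_\nu$), and let $\Theta_{\mathcal L}=i(\mathcal V)\mathcal L+\mathcal L$ and $\Omega_{\mathcal L}=-d\Theta_{\mathcal L}$ be the Poincaré–Cartan forms, that is, locally $\Theta_{\mathcal L}=\frac{\partial L}{\partial v^A_\alpha}(dy^A-v^A_\beta dx^\beta)\wedge i(\partial/\partial x^\alpha)\omega+L\,\omega$. Let $\mathcal F\mathcal L:J^1\pi\to J^1\pi^*$ be the restricted Legendre map (over the identity of $E$, with $p^\alpha_A=\partial L/\partial v^A_\alpha$). Assume that the system is almost-regular: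 $\mathcal P=\mathcal F\mathcal L(J^1\pi)$ is a closed submanifold of $J^1\pi^*$, $\mathcal F\mathcal L$ is a submersion onto $\mathcal P$, and the fibres of $\mathcal F\mathcal L$ are connected submanifolds. *Constraint submanifold.* Put $C_0=J^1\pi$ and let $C_{i+1}$ be the set of $y\in C_i$ (with image $x\in M$) for which there is a linear map $h:T_xM\to T_yC_i$ that is a right inverse of the differential of $J^1\pi\to M$ and satisfies $\Omega_{\mathcal L}(h(u_1),\dots,h(u_m),w)=0$ for all $u_i\in T_xM$ and $w\in T_yJ^1\pi$. Assume that all $C_i$ are embedded submanifolds and that $C_{k+1}=C_k$ for some $k>0$, and put $N_f=C_k$. Let $\mathcal X^{N_f}$ be a locally decomposable $m$-vector field on $N_f$ with $i(\mathcal X^{N_f})\omega=1$ and $i(\mathcal X^{N_f})\Omega_{\mathcal L}=0$ along $N_f$ that projects under $\mathcal F\mathcal L$ onto an $m$-vector field $\mathcal X^{P_f}$ on $P_f=\mathcal F\mathcal L(N_f)$. *Submanifold of semi-holonomic points.* Let $S_f=\{x\in N_f: i(\mathcal X^{N_f})\mathcal V(x)=0\}$, assume that there is a smooth map $s_f:P_f\to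 N_f$ with $\mathcal F\mathcal L\circ s_f=\mathrm{Id}$ and $s_f(P_f)=S_f$, and let $\mathcal X^{S_f}$ be the $m$-vector field on $S_f$ with $\mathcal X^{S_f}\circ s_f=\Lambda^mTs_f\circ\mathcal X^{P_f}$. *Integrability submanifold.* Let $\mathcal I_1$ be the set of points of $S_f$ at which the distribution spanned by $\mathcal X^{S_f}$ is involutive (writing locally $\mathcal X^{S_f}=X_1\wedge\dots\wedge X_m$, the brackets $[X_\mu,X_\nu](x)$ lie in the span of $X_1(x),\dots,X_m(x)$), and $\mathcal I_{i+1}=\{x\in\mathcal I_i:\mathcal X^{S_f}(x)\in\Lambda^mT_x\mathcal I_i\}$. Assume that all $\mathcal I_i$ are embedded submanifolds and that $\mathcal I_{k+1}=\mathcal I_k$ for some $k$; put $\mathcal I_f=\mathcal I_k$ and $\mathcal X^{\mathcal I_f}=\mathcal X^{S_f}|_{\mathcal I_f}$. **Theorem.** Let $U\subseteq M$ be open and let $s:U\to\mathcal I_f$ be a smooth integral section of $\mathcal X^{\mathcal I_f}$, that is, a section of $J^1\pi\to M$ over $U$ such that for every $x\in U$ the image of $\Lambda^mT_xs$ is the line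 spanned by $\mathcal X^{\mathcal I_f}(s(x))$. Then there is a smooth section $\phi:U\to E$ of $\pi$ with $s=j^1\phi$, and $\phi$ is a solution of the Euler–Lagrange equations of $\mathcal L$: in all adapted coordinates $(x^\alpha,y^A)$, writing $\mathcal L=\hat L\,dx^1\wedge\dots\wedge dx^m$, $$\frac{\partial\hat L}{\partial y^A}\circ j^1\phi=\sum_{\alpha=1}^m\frac{\partial}{\partial x^\alpha}\Big(\frac{\partial\hat L}{\partial v^A_\alpha}\circ j^1\phi\Big)\qquad\text{for all }A .$$ -/

import Mathlib

open Set
open scoped Manifold ContDiff Topology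

noncomputable section

namespace FieldTheory

/-- The model `ℝᵐ` of the base manifold `M`, with coordinates `x^α`. -/
abbrev BaseModel (m : ℕ) := EuclideanSpace ℝ (Fin m)
/-- The model `ℝⁿ` of the fibres of `π : E → M`, with coordinates `y^A`. -/
abbrev FibModel (n : ℕ) := EuclideanSpace ℝ (Fin n)
/-- The model `ℝᵐ × ℝⁿ` of the configuration manifold `E`. -/
abbrev TotModel (m n : ℕ) := BaseModel m × FibModel n

section Charts

variable {M E : Type*} {m n : ℕ}
  [TopologicalSpace M] [ChartedSpace (BaseModel m) M]
  [TopologicalSpace E] [ChartedSpace (TotModel m n) E]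

/-- `π : E → M` is a smooth fibred manifold (a surjective submersion); every smooth fibre bundle
is one. -/
class IsFibredManifold (m n : ℕ) {M E : Type*}
    [TopologicalSpace M] [ChartedSpace (BaseModel m) M]
    [TopologicalSpace E] [ChartedSpace (TotModel m n) E] (π : E → M) : Prop where
  surjective : Function.Surjective π
  submersion : Manifold.IsSubmersion 𝓘(ℝ, TotModel m n) 𝓘(ℝ, BaseModel m) ∞ π

/-- A pair of charts of `E` and `M` in which `π` is `(x, y) ↦ x`. -/
structure AdaptedChart (m n : ℕ) {M E : Type*}
    [TopologicalSpace M] [ChartedSpace (BaseModel m) M]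
    [TopologicalSpace E] [ChartedSpace (TotModel m n) E] (π : E → M) where
  tot : OpenPartialHomeomorph E (TotModel m n)
  base : OpenPartialHomeomorph M (BaseModel m)
  tot_mem : tot ∈ IsManifold.maximalAtlas 𝓘(ℝ, TotModel m n) ∞ E
  base_mem : base ∈ IsManifold.maximalAtlas 𝓘(ℝ, BaseModel m) ∞ M
  mapsTo : MapsTo π tot.source base.source
  fst_eq : ∀ y ∈ tot.source, (tot y).1 = base (π y)

theorem exists_adaptedChart [IsManifold 𝓘(ℝ, TotModel m n) ∞ E] {π : E → M} (hπ : IsFibredManifold m n π) (y : E) :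
    ∃ a : AdaptedChart m n π, y ∈ a.tot.source := by
  obtain ⟨F, _, _, hF⟩ := hπ.submersion
  have h := hF y
  let e := h.equiv
  have hfF : FiniteDimensional ℝ F := by
    have : FiniteDimensional ℝ (BaseModel m × F) := e.toLinearEquiv.finiteDimensional
    exact Module.Finite.of_surjective (LinearMap.snd ℝ (BaseModel m) F) LinearMap.snd_surjective
  have hdim : Module.finrank ℝ F = Module.finrank ℝ (FibModel n) := by
    have := e.toLinearEquiv.finrank_eq
    rw [Module.finrank_prod, Module.finrank_prod] at this
    omega
  let k : F ≃L[ℝ] FibModel n := ContinuousLinearEquiv.ofFinrankEq hdim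
  let g : TotModel m n ≃L[ℝ] TotModel m n :=
    e.trans ((ContinuousLinearEquiv.refl ℝ (BaseModel m)).prodCongr k)
  have hg : ∀ z, (g z).1 = (e z).1 := fun z => rfl
  refine ⟨⟨h.domChart.transHomeomorph g.toHomeomorph, h.codChart, ?_, h.codChart_mem_maximalAtlas,
    ?_, ?_⟩, ?_⟩
  · rw [IsManifold.mem_maximalAtlas_iff_contMDiffOn]
    constructor
    · exact g.contDiff.contMDiff.comp_contMDiffOn
        (contMDiffOn_of_mem_maximalAtlas h.domChart_mem_maximalAtlas)
    · exact (contMDiffOn_symm_of_mem_maximalAtlas h.domChart_mem_maximalAtlas).comp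
        g.symm.contDiff.contMDiff.contMDiffOn (fun z hz => by simpa using hz)
  · intro z hz
    exact h.source_subset_preimage_source (by simpa using hz)
  · intro z hz
    have hz' : z ∈ h.domChart.source := by simpa using hz
    have hz2 : h.domChart z ∈ (h.domChart.extend 𝓘(ℝ, TotModel m n)).target := by
      simpa using h.domChart.map_source hz'
    have := h.writtenInCharts hz2
    simp [h.domChart.left_inv hz'] at this
    simpa [hg] using this.symm
  · simpa using h.mem_domChart_source

end Charts

section ChartDeriv

variable {V X : Type*} [NormedAddCommGroup V] [NormedSpace ℝ V]
  [TopologicalSpace X] [ChartedSpace V X]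

/-- The differential at `x` of a chart `e : X → V`. -/
def chartDeriv (e : OpenPartialHomeomorph X V) (x : X) : TangentSpace 𝓘(ℝ, V) x →L[ℝ] V :=
  mfderiv 𝓘(ℝ, V) 𝓘(ℝ, V) e x

variable {e e' : OpenPartialHomeomorph X V}

theorem chart_mdifferentiable (he : e ∈ IsManifold.maximalAtlas 𝓘(ℝ, V) ∞ X) :
    e.MDifferentiable 𝓘(ℝ, V) 𝓘(ℝ, V) :=
  ⟨(contMDiffOn_of_mem_maximalAtlas he).mdifferentiableOn (by simp),
    (contMDiffOn_symm_of_mem_maximalAtlas he).mdifferentiableOn (by simp)⟩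

theorem chartDeriv_isInvertible (he : e ∈ IsManifold.maximalAtlas 𝓘(ℝ, V) ∞ X) {x : X}
    (hx : x ∈ e.source) : (chartDeriv e x).IsInvertible :=
  ⟨(chart_mdifferentiable he).mfderiv hx, rfl⟩

theorem contDiffOn_transition (he : e ∈ IsManifold.maximalAtlas 𝓘(ℝ, V) ∞ X)
    (he' : e' ∈ IsManifold.maximalAtlas 𝓘(ℝ, V) ∞ X) :
    ContDiffOn ℝ ∞ (e' ∘ e.symm) (e.symm ≫ₕ e').source := by
  rw [← contMDiffOn_iff_contDiffOn]
  exact (contMDiffOn_of_mem_maximalAtlas he').comp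
    ((contMDiffOn_symm_of_mem_maximalAtlas he).mono (fun z hz => by simpa using hz.1))
    (fun z hz => by simpa using hz.2)

theorem contDiffOn_fderiv_transition (he : e ∈ IsManifold.maximalAtlas 𝓘(ℝ, V) ∞ X)
    (he' : e' ∈ IsManifold.maximalAtlas 𝓘(ℝ, V) ∞ X) :
    ContDiffOn ℝ ∞ (fderiv ℝ (e' ∘ e.symm)) (e.symm ≫ₕ e').source :=
  (contDiffOn_transition he he').fderiv_of_isOpen (e.symm ≫ₕ e').open_source (by simp)

theorem chartDeriv_transition (he : e ∈ IsManifold.maximalAtlas 𝓘(ℝ, V) ∞ X)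
    (he' : e' ∈ IsManifold.maximalAtlas 𝓘(ℝ, V) ∞ X) {x : X} (hx : x ∈ e.source)
    (hx' : x ∈ e'.source) :
    chartDeriv e' x = (fderiv ℝ (e' ∘ e.symm) (e x)).comp (chartDeriv e x) := by
  have hmem : e x ∈ (e.symm ≫ₕ e').source := by
    simp [hx, hx']
  have hd : DifferentiableAt ℝ (e' ∘ e.symm) (e x) :=
    ((contDiffOn_transition he he').differentiableOn (by simp)).differentiableAt
      ((e.symm ≫ₕ e').open_source.mem_nhds hmem)
  have h1 : HasMFDerivAt 𝓘(ℝ, V) 𝓘(ℝ, V) e x (mfderiv 𝓘(ℝ, V) 𝓘(ℝ, V) e x) :=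
    ((chart_mdifferentiable he).mdifferentiableAt hx).hasMFDerivAt
  have h2 := (hd.hasFDerivAt.hasMFDerivAt).comp x h1
  have h3 : (e' ∘ e.symm) ∘ e =ᶠ[𝓝 x] e' := by
    filter_upwards [e.open_source.mem_nhds hx] with z hz
    simp [hz]
  exact (h2.congr_of_eventuallyEq h3.symm).mfderiv

end ChartDeriv

section AdaptedCharts

variable {M E : Type*} {m n : ℕ}
  [TopologicalSpace M] [ChartedSpace (BaseModel m) M]
  [TopologicalSpace E] [ChartedSpace (TotModel m n) E] {π : E → M}

/-- The differential of the projection `π`. -/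
abbrev dproj (m n : ℕ) {M E : Type*}
    [TopologicalSpace M] [ChartedSpace (BaseModel m) M]
    [TopologicalSpace E] [ChartedSpace (TotModel m n) E] (π : E → M) (y : E) :
    TangentSpace 𝓘(ℝ, TotModel m n) y →L[ℝ] TangentSpace 𝓘(ℝ, BaseModel m) (π y) :=
  mfderiv 𝓘(ℝ, TotModel m n) 𝓘(ℝ, BaseModel m) π y

theorem AdaptedChart.chartDeriv_comp_dproj (hπ : IsFibredManifold m n π) (a : AdaptedChart m n π) {y : E} (hy : y ∈ a.tot.source) :
    (chartDeriv a.base (π y)).comp (dproj m n π y) =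
      (ContinuousLinearMap.fst ℝ (BaseModel m) (FibModel n)).comp (chartDeriv a.tot y) := by
  have hs : ContMDiff 𝓘(ℝ, TotModel m n) 𝓘(ℝ, BaseModel m) ∞ π := hπ.submersion.contMDiff
  have h1 : HasMFDerivAt 𝓘(ℝ, TotModel m n) 𝓘(ℝ, BaseModel m) π y (dproj m n π y) :=
    (hs.mdifferentiable (by simp) y).hasMFDerivAt
  have h2 := (((chart_mdifferentiable a.base_mem).mdifferentiableAt
    (a.mapsTo hy)).hasMFDerivAt).comp y h1
  have h3 := ((chart_mdifferentiable a.tot_mem).mdifferentiableAt hy).hasMFDerivAt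
  have h4 := ((ContinuousLinearMap.fst ℝ (BaseModel m) (FibModel n)).hasMFDerivAt (x := a.tot y)).comp y h3
  have h5 : a.base ∘ π =ᶠ[𝓝 y] (ContinuousLinearMap.fst ℝ (BaseModel m) (FibModel n)) ∘ a.tot := by
    filter_upwards [a.tot.open_source.mem_nhds hy] with z hz
    simp [a.fst_eq z hz]
  exact (hasMFDerivAt_unique (h2.congr_of_eventuallyEq h5.symm) h4)

end AdaptedCharts

section FibreCoords

variable {m n : ℕ} {M E : Type*}
  [TopologicalSpace M] [ChartedSpace (BaseModel m) M]
  [TopologicalSpace E] [ChartedSpace (TotModel m n) E]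

/-- Data turning a set `Q` over `E` into a smooth bundle over `E` with typical fibre `F`: over every
adapted chart `a` a fibre coordinate `coord a` with inverse `glue a`, and smooth transitions. -/
structure FibreCoords (m n : ℕ) {M E : Type*}
    [TopologicalSpace M] [ChartedSpace (BaseModel m) M]
    [TopologicalSpace E] [ChartedSpace (TotModel m n) E]
    (π : E → M) (Q F : Type*) [NormedAddCommGroup F] [NormedSpace ℝ F] where
  proj : Q → E
  coord : AdaptedChart m n π → Q → F
  glue : ∀ (a : AdaptedChart m n π) (y : E), y ∈ a.tot.source → F → Q
  trans : AdaptedChart m n π → AdaptedChart m n π → TotModel m n → F → F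
  proj_glue : ∀ a y hy v, proj (glue a y hy v) = y
  coord_glue : ∀ a y hy v, coord a (glue a y hy v) = v
  glue_coord : ∀ a q (hq : proj q ∈ a.tot.source), glue a (proj q) hq (coord a q) = q
  coord_trans : ∀ a b q, proj q ∈ a.tot.source → proj q ∈ b.tot.source →
    coord b q = trans a b (a.tot (proj q)) (coord a q)
  contDiffOn_trans : ∀ a b, ContDiffOn ℝ ∞ (fun z : TotModel m n × F => trans a b z.1 z.2)
    ((a.tot.symm ≫ₕ b.tot).source ×ˢ univ)

variable {π : E → M} {Q F : Type*} [NormedAddCommGroup F] [NormedSpace ℝ F]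

namespace FibreCoords

open Classical in
/-- The bundle chart `q ↦ (a.tot (proj q), coord a q)` over the adapted chart `a`. The point `q₀`
only serves as the value of the inverse outside the target. -/
def chart (c : FibreCoords m n π Q F) (a : AdaptedChart m n π) (q₀ : Q) :
    PartialEquiv Q (TotModel m n × F) where
  toFun q := (a.tot (c.proj q), c.coord a q)
  invFun z := if h : z.1 ∈ a.tot.target
    then c.glue a (a.tot.symm z.1) (a.tot.map_target h) z.2 else q₀
  source := c.proj ⁻¹' a.tot.source
  target := a.tot.target ×ˢ univ
  map_source' q hq := ⟨a.tot.map_source hq, mem_univ _⟩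
  map_target' z hz := by
    simp only [mem_preimage]
    rw [dif_pos hz.1, c.proj_glue]
    exact a.tot.map_target hz.1
  left_inv' q hq := by
    have h : a.tot (c.proj q) ∈ a.tot.target := a.tot.map_source hq
    rw [dif_pos h]
    have key : ∀ y (hy : y ∈ a.tot.source), y = c.proj q → c.glue a y hy (c.coord a q) = q := by
      rintro y hy rfl
      exact c.glue_coord a q hy
    exact key _ _ (a.tot.left_inv hq)
  right_inv' z hz := by
    rw [dif_pos hz.1, c.proj_glue, c.coord_glue, a.tot.right_inv hz.1]

theorem chart_trans_source (c : FibreCoords m n π Q F) (a b : AdaptedChart m n π) (q₀ q₁ : Q) :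
    ((c.chart a q₀).symm.trans (c.chart b q₁)).source =
      (a.tot.symm ≫ₕ b.tot).source ×ˢ univ := by
  ext z
  simp only [PartialEquiv.trans_source, PartialEquiv.symm_source, mem_inter_iff, mem_preimage,
    mem_prod, mem_univ, and_true, OpenPartialHomeomorph.trans_source,
    OpenPartialHomeomorph.symm_source]
  constructor
  · rintro ⟨h1, h2⟩
    have h1' : z.1 ∈ a.tot.target := h1.1
    refine ⟨h1', ?_⟩
    have h2' : c.proj ((c.chart a q₀).symm z) ∈ b.tot.source := h2
    have : (c.chart a q₀).symm z = c.glue a (a.tot.symm z.1) (a.tot.map_target h1') z.2 :=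
      dif_pos h1'
    rwa [this, c.proj_glue] at h2'
  · rintro ⟨h1, h2⟩
    refine ⟨⟨h1, mem_univ _⟩, ?_⟩
    change c.proj ((c.chart a q₀).symm z) ∈ b.tot.source
    have : (c.chart a q₀).symm z = c.glue a (a.tot.symm z.1) (a.tot.map_target h1) z.2 :=
      dif_pos h1
    rwa [this, c.proj_glue]

theorem contDiffOn_chart_trans (c : FibreCoords m n π Q F) (a b : AdaptedChart m n π) (q₀ q₁ : Q) :
    ContDiffOn ℝ ∞ ((c.chart a q₀).symm.trans (c.chart b q₁))
      ((c.chart a q₀).symm.trans (c.chart b q₁)).source := by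
  rw [chart_trans_source]
  have h : ContDiffOn ℝ ∞ (fun z : TotModel m n × F =>
      (((b.tot ∘ a.tot.symm) z.1, c.trans a b z.1 z.2) : TotModel m n × F))
      ((a.tot.symm ≫ₕ b.tot).source ×ˢ univ) :=
    ((contDiffOn_transition a.tot_mem b.tot_mem).comp contDiffOn_fst (fun z hz => hz.1)).prodMk
      (c.contDiffOn_trans a b)
  refine h.congr ?_
  rintro z ⟨hz, -⟩
  have hz1 : z.1 ∈ a.tot.target := by simpa using hz.1
  have hz2 : a.tot.symm z.1 ∈ b.tot.source := by simpa using hz.2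
  have : (c.chart a q₀).symm z = c.glue a (a.tot.symm z.1) (a.tot.map_target hz1) z.2 :=
    dif_pos hz1
  change (b.tot (c.proj ((c.chart a q₀).symm z)), c.coord b ((c.chart a q₀).symm z)) = _
  rw [this, c.proj_glue, c.coord_trans a b _ (by rw [c.proj_glue]; exact a.tot.map_target hz1)
    (by rw [c.proj_glue]; exact hz2), c.proj_glue, c.coord_glue, a.tot.right_inv hz1]
  rfl

variable [IsManifold 𝓘(ℝ, TotModel m n) ∞ E]

/-- The charted space structure on `Q` given by the bundle charts. -/
def core (hπ : IsFibredManifold m n π) (c : FibreCoords m n π Q F) :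
    ChartedSpaceCore (TotModel m n × F) Q where
  atlas := range fun p : AdaptedChart m n π × Q => c.chart p.1 p.2
  chartAt q := c.chart (exists_adaptedChart hπ (c.proj q)).choose q
  mem_chart_source q := (exists_adaptedChart hπ (c.proj q)).choose_spec
  chart_mem_atlas q := ⟨(_, q), rfl⟩
  open_source := by
    rintro _ _ ⟨p, rfl⟩ ⟨p', rfl⟩
    rw [chart_trans_source]
    exact (OpenPartialHomeomorph.open_source _).prod isOpen_univ
  continuousOn_toFun := by
    rintro _ _ ⟨p, rfl⟩ ⟨p', rfl⟩
    exact (c.contDiffOn_chart_trans _ _ _ _).continuousOn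

theorem isManifold_core (hπ : IsFibredManifold m n π) (c : FibreCoords m n π Q F) :
    @IsManifold ℝ _ _ _ _ _ _ 𝓘(ℝ, TotModel m n × F) ∞ Q (c.core hπ).toTopologicalSpace
      (c.core hπ).toChartedSpace := by
  let _ := (c.core hπ).toTopologicalSpace
  let _ := (c.core hπ).toChartedSpace
  refine isManifold_of_contDiffOn _ _ _ ?_
  intro e e' he he'
  obtain ⟨_, ⟨f, rfl⟩, hf⟩ := he
  obtain ⟨_, ⟨f', rfl⟩, hf'⟩ := he'
  simp only [mem_iUnion, mem_singleton_iff] at hf hf'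
  obtain ⟨⟨p, rfl⟩, rfl⟩ := hf
  obtain ⟨⟨p', rfl⟩, rfl⟩ := hf'
  simpa using! c.contDiffOn_chart_trans p.1 p'.1 p.2 p'.2

end FibreCoords

end FibreCoords

section JetBundle

variable {m n : ℕ} {M E : Type*}
  [TopologicalSpace M] [ChartedSpace (BaseModel m) M]
  [TopologicalSpace E] [ChartedSpace (TotModel m n) E]

/-- A point of the first jet bundle `J¹π`: a point `y` of `E` and a linear map
`T_{π y} M → T_y E` that is a right inverse of `T_y π`. -/
structure Jet (m n : ℕ) {M E : Type*}
    [TopologicalSpace M] [ChartedSpace (BaseModel m) M]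
    [TopologicalSpace E] [ChartedSpace (TotModel m n) E] (π : E → M) where
  pt : E
  hor : TangentSpace 𝓘(ℝ, BaseModel m) (π pt) →L[ℝ] TangentSpace 𝓘(ℝ, TotModel m n) pt
  dproj_comp_hor : (dproj m n π pt).comp hor = ContinuousLinearMap.id ℝ _

/-- `Hom (T_{π y} M, V_y π)`, as the linear maps `A : T_{π y} M → T_y E` with `Tπ ∘ A = 0`. It is the
space of translations of the fibre of `J¹π` over `y`. -/
abbrev VertHom (m n : ℕ) {M E : Type*}
    [TopologicalSpace M] [ChartedSpace (BaseModel m) M]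
    [TopologicalSpace E] [ChartedSpace (TotModel m n) E] (π : E → M) (y : E) :
    Submodule ℝ
      (TangentSpace 𝓘(ℝ, BaseModel m) (π y) →L[ℝ] TangentSpace 𝓘(ℝ, TotModel m n) y) :=
  LinearMap.ker (ContinuousLinearMap.postcomp (TangentSpace 𝓘(ℝ, BaseModel m) (π y)) (dproj m n π y)).toLinearMap

/-- A point of the restricted multimomentum bundle `J¹π*`: a point `y` of `E` and a linear form on
`Hom (T_{π y} M, V_y π)`. A volume form `η` identifies this fibre with
`Λᵐ₂ T*_y E / π* Λᵐ T*_{π y} M`, the class of `ξ` acting on `A` by the number `c` such that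
`∑ i, ξ (h e₁, …, A e_i, …, h e_m) = c * η (e₁, …, e_m)` for any lift `h` of `T_{π y} M` to `T_y E`. -/
structure Momentum (m n : ℕ) {M E : Type*}
    [TopologicalSpace M] [ChartedSpace (BaseModel m) M]
    [TopologicalSpace E] [ChartedSpace (TotModel m n) E] (π : E → M) where
  pt : E
  mom : Module.Dual ℝ (VertHom m n π pt)

/-- The space of the fibre coordinates `v^A_α` of `J¹π`. -/
abbrev JetFib (m n : ℕ) := BaseModel m →L[ℝ] FibModel n
/-- The space of the fibre coordinates `p^α_A` of `J¹π*`. -/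
abbrev MomFib (m n : ℕ) := JetFib m n →L[ℝ] ℝ

variable {π : E → M}

theorem VertHom.mem_iff {y : E} (A : TangentSpace 𝓘(ℝ, BaseModel m) (π y) →L[ℝ] TangentSpace 𝓘(ℝ, TotModel m n) y) : A ∈ VertHom m n π y ↔ (dproj m n π y).comp A = 0 := Iff.rfl

namespace AdaptedChart

variable (a b : AdaptedChart m n π)

/-- The linear map `T_{π y} M → T_y E` with coordinate expression `u ↦ (α u, v u)`. -/
def toTangent (y : E) (α : BaseModel m →L[ℝ] BaseModel m) (v : JetFib m n) :
    TangentSpace 𝓘(ℝ, BaseModel m) (π y) →L[ℝ] TangentSpace 𝓘(ℝ, TotModel m n) y :=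
  (chartDeriv a.tot y).inverse.comp
    ((ContinuousLinearMap.inl ℝ (BaseModel m) (FibModel n) ∘L α +
      ContinuousLinearMap.inr ℝ (BaseModel m) (FibModel n) ∘L v).comp (chartDeriv a.base (π y)))

/-- The fibre coordinates of `A : T_{π y} M → T_y E`: the `y`-part of the coordinate expression. -/
def ofTangent (y : E)
    (A : TangentSpace 𝓘(ℝ, BaseModel m) (π y) →L[ℝ] TangentSpace 𝓘(ℝ, TotModel m n) y) :
    JetFib m n :=
  (ContinuousLinearMap.snd ℝ (BaseModel m) (FibModel n)).comp
    ((chartDeriv a.tot y).comp (A.comp (chartDeriv a.base (π y)).inverse))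

theorem ofTangent_toTangent {y : E} (hy : y ∈ a.tot.source) (α : BaseModel m →L[ℝ] BaseModel m)
    (v : JetFib m n) : a.ofTangent y (a.toTangent y α v) = v := by
  have h1 := chartDeriv_isInvertible a.tot_mem hy
  have h2 := chartDeriv_isInvertible a.base_mem (a.mapsTo hy)
  ext u
  simp [ofTangent, toTangent, h1, h2]


theorem dproj_comp_toTangent (hπ : IsFibredManifold m n π) {y : E} (hy : y ∈ a.tot.source)
    (α : BaseModel m →L[ℝ] BaseModel m) (v : JetFib m n) :
    (dproj m n π y).comp (a.toTangent y α v) =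
      (chartDeriv a.base (π y)).inverse.comp (α.comp (chartDeriv a.base (π y))) := by
  have h1 := chartDeriv_isInvertible a.tot_mem hy
  have h2 := chartDeriv_isInvertible a.base_mem (a.mapsTo hy)
  ext u
  have h3 := DFunLike.congr_fun (a.chartDeriv_comp_dproj hπ hy) (a.toTangent y α v u)
  simp only [ContinuousLinearMap.comp_apply] at h3 ⊢
  rw [eq_comm, h2.inverse_apply_eq, h3]
  simp [toTangent, h1]

theorem toTangent_ofTangent (hπ : IsFibredManifold m n π) {y : E} (hy : y ∈ a.tot.source)
    (α : BaseModel m →L[ℝ] BaseModel m)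
    (A : TangentSpace 𝓘(ℝ, BaseModel m) (π y) →L[ℝ] TangentSpace 𝓘(ℝ, TotModel m n) y)
    (hA : (dproj m n π y).comp A =
      (chartDeriv a.base (π y)).inverse.comp (α.comp (chartDeriv a.base (π y)))) :
    a.toTangent y α (a.ofTangent y A) = A := by
  have h1 := chartDeriv_isInvertible a.tot_mem hy
  have h2 := chartDeriv_isInvertible a.base_mem (a.mapsTo hy)
  ext u
  have h3 := DFunLike.congr_fun (a.chartDeriv_comp_dproj hπ hy) (A u)
  have h4 := DFunLike.congr_fun hA u
  simp only [ContinuousLinearMap.comp_apply] at h3 h4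
  rw [h4] at h3
  simp only [toTangent, ContinuousLinearMap.comp_apply]
  rw [h1.inverse_apply_eq]
  refine Prod.ext ?_ ?_
  · simpa [h2] using h3
  · simp [ofTangent, h2]

/-- The change of coordinates for linear maps `T_{π y} M → T_y E` with coordinate expression
`u ↦ (α u, v u)`. -/
def jetTrans (z : TotModel m n) (α : BaseModel m →L[ℝ] BaseModel m) (v : JetFib m n) :
    JetFib m n :=
  (ContinuousLinearMap.snd ℝ (BaseModel m) (FibModel n)).comp
    ((fderiv ℝ (b.tot ∘ a.tot.symm) z).comp
      ((ContinuousLinearMap.inl ℝ (BaseModel m) (FibModel n) ∘L α +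
        ContinuousLinearMap.inr ℝ (BaseModel m) (FibModel n) ∘L v).comp
          (fderiv ℝ (a.base ∘ b.base.symm) ((b.tot ∘ a.tot.symm) z).1)))

theorem ofTangent_eq_jetTrans {y : E} (hy : y ∈ a.tot.source)
    (hy' : y ∈ b.tot.source) (α : BaseModel m →L[ℝ] BaseModel m) (v : JetFib m n) :
    b.ofTangent y (a.toTangent y α v) = jetTrans a b (a.tot y) α v := by
  have h1 := chartDeriv_isInvertible a.tot_mem hy
  have h2 := chartDeriv_isInvertible b.base_mem (b.mapsTo hy')
  have h3 := chartDeriv_transition a.tot_mem b.tot_mem hy hy'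
  have h4 := chartDeriv_transition b.base_mem a.base_mem (b.mapsTo hy') (a.mapsTo hy)
  have h5 : ((b.tot ∘ a.tot.symm) (a.tot y)).1 = b.base (π y) := by
    simp [a.tot.left_inv hy, b.fst_eq y hy']
  ext1 u
  simp only [ofTangent, toTangent, jetTrans, ContinuousLinearMap.comp_apply, h3, h4, h5]
  simp [h1, h2]

theorem contDiffOn_jetTrans (α : BaseModel m →L[ℝ] BaseModel m) :
    ContDiffOn ℝ ∞ (fun z : TotModel m n × JetFib m n => jetTrans a b z.1 α z.2)
      ((a.tot.symm ≫ₕ b.tot).source ×ˢ univ) := by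
  have hF : ContDiffOn ℝ ∞ (fun z : TotModel m n × JetFib m n =>
      fderiv ℝ (b.tot ∘ a.tot.symm) z.1) ((a.tot.symm ≫ₕ b.tot).source ×ˢ univ) :=
    (contDiffOn_fderiv_transition a.tot_mem b.tot_mem).comp contDiffOn_fst (fun z hz => hz.1)
  have hG : ContDiffOn ℝ ∞ (fun z : TotModel m n × JetFib m n =>
      fderiv ℝ (a.base ∘ b.base.symm) ((b.tot ∘ a.tot.symm) z.1).1)
      ((a.tot.symm ≫ₕ b.tot).source ×ˢ univ) := by
    refine (contDiffOn_fderiv_transition b.base_mem a.base_mem).comp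
      (contDiff_fst.comp_contDiffOn
        ((contDiffOn_transition a.tot_mem b.tot_mem).comp contDiffOn_fst (fun z hz => hz.1))) ?_
    rintro z ⟨hz, -⟩
    have hz1 : z.1 ∈ a.tot.target := by simpa using hz.1
    have hz2 : a.tot.symm z.1 ∈ b.tot.source := by simpa using hz.2
    have h5 : ((b.tot ∘ a.tot.symm) z.1).1 = b.base (π (a.tot.symm z.1)) := b.fst_eq _ hz2
    simp only [h5, OpenPartialHomeomorph.trans_source, OpenPartialHomeomorph.symm_source,
      mem_inter_iff, mem_preimage]
    refine ⟨b.base.map_source (b.mapsTo hz2), ?_⟩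
    rw [b.base.left_inv (b.mapsTo hz2)]
    exact a.mapsTo (a.tot.map_target hz1)
  have hv : ContDiff ℝ ∞ (fun z : TotModel m n × JetFib m n =>
      ContinuousLinearMap.inl ℝ (BaseModel m) (FibModel n) ∘L α +
        ContinuousLinearMap.inr ℝ (BaseModel m) (FibModel n) ∘L z.2) :=
    contDiff_const.add (contDiff_const.clm_comp contDiff_snd)
  exact contDiffOn_const.clm_comp (hF.clm_comp (hv.contDiffOn.clm_comp hG))

end AdaptedChart

/-- Coordinates `v^A_α` on `J¹π`. -/
def jetCoords (hπ : IsFibredManifold m n π) : FibreCoords m n π (Jet m n π) (JetFib m n) where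
  proj := Jet.pt
  coord a j := a.ofTangent j.pt j.hor
  glue a y hy v := ⟨y, a.toTangent y (.id ℝ _) v, by
    rw [a.dproj_comp_toTangent hπ hy]
    have h2 := chartDeriv_isInvertible a.base_mem (a.mapsTo hy)
    ext1 u
    simp [h2]⟩
  trans a b z v := AdaptedChart.jetTrans a b z (.id ℝ _) v
  proj_glue _ _ _ _ := rfl
  coord_glue a y hy v := a.ofTangent_toTangent hy _ v
  glue_coord a q hq := by
    obtain ⟨y, h, hh⟩ := q
    congr 1
    refine a.toTangent_ofTangent hπ hq _ _ ?_
    have h2 := chartDeriv_isInvertible a.base_mem (a.mapsTo hq)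
    rw [hh]
    ext1 u
    simp [h2]
  coord_trans a b q hq hq' := by
    rw [← a.ofTangent_eq_jetTrans b hq hq', a.toTangent_ofTangent hπ hq]
    have h2 := chartDeriv_isInvertible a.base_mem (a.mapsTo hq)
    rw [q.dproj_comp_hor]
    ext1 u
    simp [h2]
  contDiffOn_trans a b := a.contDiffOn_jetTrans b _

namespace AdaptedChart

variable (a b : AdaptedChart m n π)

theorem toTangent_mem_vertHom (hπ : IsFibredManifold m n π) {y : E} (hy : y ∈ a.tot.source)
    (v : JetFib m n) : a.toTangent y 0 v ∈ VertHom m n π y := by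
  rw [VertHom.mem_iff, a.dproj_comp_toTangent hπ hy]
  simp

/-- The vertical linear map with coordinates `v`. -/
def toVertHom (hπ : IsFibredManifold m n π) (y : E) (hy : y ∈ a.tot.source) :
    JetFib m n →ₗ[ℝ] VertHom m n π y where
  toFun v := ⟨a.toTangent y 0 v, a.toTangent_mem_vertHom hπ hy v⟩
  map_add' v w := by
    ext u
    simp [toTangent]
  map_smul' r v := by
    ext u
    simp [toTangent]

/-- The coordinates of a vertical linear map. -/
def ofVertHom (y : E) : VertHom m n π y →ₗ[ℝ] JetFib m n where
  toFun A := a.ofTangent y A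
  map_add' v w := by
    ext u
    simp [ofTangent]
  map_smul' r v := by
    ext u
    simp [ofTangent]

theorem ofVertHom_toVertHom (hπ : IsFibredManifold m n π) {y : E} (hy : y ∈ a.tot.source)
    (v : JetFib m n) : a.ofVertHom y (a.toVertHom hπ y hy v) = v :=
  a.ofTangent_toTangent hy 0 v

theorem toVertHom_ofVertHom (hπ : IsFibredManifold m n π) {y : E} (hy : y ∈ a.tot.source)
    (A : VertHom m n π y) : a.toVertHom hπ y hy (a.ofVertHom y A) = A :=
  Subtype.ext (a.toTangent_ofTangent hπ hy 0 A (by rw [(VertHom.mem_iff _).1 A.2]; simp))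

/-- The linear part of the transition of jet coordinates, as a continuous linear map. -/
def jetTransL (z : TotModel m n) : JetFib m n →L[ℝ] JetFib m n :=
  (ContinuousLinearMap.compL ℝ (BaseModel m) (FibModel n) (FibModel n)
    ((ContinuousLinearMap.snd ℝ (BaseModel m) (FibModel n)).comp
      ((fderiv ℝ (b.tot ∘ a.tot.symm) z).comp
        (ContinuousLinearMap.inr ℝ (BaseModel m) (FibModel n))))).comp
  ((ContinuousLinearMap.compL ℝ (BaseModel m) (BaseModel m) (FibModel n)).flip
    (fderiv ℝ (a.base ∘ b.base.symm) ((b.tot ∘ a.tot.symm) z).1))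

theorem jetTransL_apply (z : TotModel m n) (v : JetFib m n) :
    jetTransL a b z v = jetTrans a b z 0 v := by
  ext1 u
  simp [jetTransL, jetTrans]

end AdaptedChart

open Classical in
/-- Coordinates `p^α_A` on `J¹π*`. -/
def momentumCoords (hπ : IsFibredManifold m n π) :
    FibreCoords m n π (Momentum m n π) (MomFib m n) where
  proj := Momentum.pt
  coord a p := if h : p.pt ∈ a.tot.source then
    LinearMap.toContinuousLinearMap (p.mom ∘ₗ a.toVertHom hπ p.pt h) else 0
  glue a y _ P := ⟨y, P.toLinearMap ∘ₗ a.ofVertHom y⟩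
  trans a b z P := P.comp (AdaptedChart.jetTransL b a ((b.tot ∘ a.tot.symm) z))
  proj_glue _ _ _ _ := rfl
  coord_glue a y hy P := by
    rw [dif_pos hy]
    ext v
    simp [a.ofVertHom_toVertHom hπ hy]
  glue_coord a p hp := by
    rw [dif_pos hp]
    obtain ⟨y, p⟩ := p
    congr 1
    ext A
    simp [a.toVertHom_ofVertHom hπ hp]
  coord_trans a b p hp hp' := by
    rw [dif_pos hp, dif_pos hp']
    ext v
    have h1 : (b.tot ∘ a.tot.symm) (a.tot p.pt) = b.tot p.pt := by simp [a.tot.left_inv hp]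
    simp only [LinearMap.coe_toContinuousLinearMap', LinearMap.comp_apply,
      ContinuousLinearMap.comp_apply, h1, AdaptedChart.jetTransL_apply]
    rw [← b.ofTangent_eq_jetTrans a hp' hp]
    congr 1
    exact (a.toVertHom_ofVertHom hπ hp (b.toVertHom hπ p.pt hp' v)).symm
  contDiffOn_trans a b := by
    refine contDiffOn_snd.clm_comp ?_
    have hmaps : MapsTo (b.tot ∘ a.tot.symm) (a.tot.symm ≫ₕ b.tot).source
        (b.tot.symm ≫ₕ a.tot).source := by
      intro z hz
      have hz1 : z ∈ a.tot.target := by simpa using hz.1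
      have hz2 : a.tot.symm z ∈ b.tot.source := by simpa using hz.2
      simp [hz2, hz1]
    have hba : ContDiffOn ℝ ∞ (AdaptedChart.jetTransL b a) (b.tot.symm ≫ₕ a.tot).source := by
      have hF := contDiffOn_fderiv_transition b.tot_mem a.tot_mem
      have hG : ContDiffOn ℝ ∞ (fun z : TotModel m n =>
          fderiv ℝ (b.base ∘ a.base.symm) ((a.tot ∘ b.tot.symm) z).1)
          (b.tot.symm ≫ₕ a.tot).source := by
        refine (contDiffOn_fderiv_transition a.base_mem b.base_mem).comp
          (contDiff_fst.comp_contDiffOn (contDiffOn_transition b.tot_mem a.tot_mem)) ?_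
        intro z hz
        have hz1 : z ∈ b.tot.target := by simpa using hz.1
        have hz2 : b.tot.symm z ∈ a.tot.source := by simpa using hz.2
        have h5 : ((a.tot ∘ b.tot.symm) z).1 = a.base (π (b.tot.symm z)) := a.fst_eq _ hz2
        simp only [h5, OpenPartialHomeomorph.trans_source, OpenPartialHomeomorph.symm_source,
          mem_inter_iff, mem_preimage]
        refine ⟨a.base.map_source (a.mapsTo hz2), ?_⟩
        rw [a.base.left_inv (a.mapsTo hz2)]
        exact b.mapsTo (b.tot.map_target hz1)
      exact (contDiffOn_const.clm_apply
        (contDiffOn_const.clm_comp (hF.clm_comp contDiffOn_const))).clm_comp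
        (contDiffOn_const.clm_apply hG)
    exact (hba.comp (contDiffOn_transition a.tot_mem b.tot_mem) hmaps).comp contDiffOn_fst
      (fun z hz => hz.1)

section Instances

variable [IsManifold 𝓘(ℝ, TotModel m n) ∞ E] [hπ : IsFibredManifold m n π]

/-- The topology, the atlas and the smooth structure of `J¹π` given by the coordinates
`(x^α, y^A, v^A_α)`, and below those of `J¹π*` given by `(x^α, y^A, p^α_A)`. -/
instance : TopologicalSpace (Jet m n π) := ((jetCoords hπ).core hπ).toTopologicalSpace
instance : ChartedSpace (TotModel m n × JetFib m n) (Jet m n π) :=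
  ((jetCoords hπ).core hπ).toChartedSpace
instance : IsManifold 𝓘(ℝ, TotModel m n × JetFib m n) ∞ (Jet m n π) :=
  (jetCoords hπ).isManifold_core hπ

instance : TopologicalSpace (Momentum m n π) := ((momentumCoords hπ).core hπ).toTopologicalSpace
instance : ChartedSpace (TotModel m n × MomFib m n) (Momentum m n π) :=
  ((momentumCoords hπ).core hπ).toChartedSpace
instance : IsManifold 𝓘(ℝ, TotModel m n × MomFib m n) ∞ (Momentum m n π) :=
  (momentumCoords hπ).isManifold_core hπ

end Instances

end JetBundle

section Multilinear

open Function in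
/-- The alternating map `w ↦ ∑ i, α (T w₁, …, u, …, T wₘ) • P (w i)`, with `u` in the `i`-th slot. -/
def insertSum {ι V B F : Type*} [Fintype ι] [dι : DecidableEq ι]
    [AddCommGroup V] [Module ℝ V] [AddCommGroup B] [Module ℝ B] [AddCommGroup F] [Module ℝ F]
    (α : B [⋀^ι]→ₗ[ℝ] ℝ) (T : V →ₗ[ℝ] B) (P : V →ₗ[ℝ] F) (u : B) : V [⋀^ι]→ₗ[ℝ] F where
  toFun w := ∑ i, α (update (T ∘ w) i u) • P (w i)
  map_update_add' {inst} w i x y := by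
    cases Subsingleton.elim inst dι
    rw [← Finset.sum_add_distrib]
    refine Finset.sum_congr rfl fun k _ => ?_
    by_cases hk : k = i
    · subst hk
      simp [Function.comp_update]
    · simp [hk, Function.comp_update, update_comm (Ne.symm hk), add_smul]
  map_update_smul' {inst} w i c x := by
    cases Subsingleton.elim inst dι
    rw [Finset.smul_sum]
    refine Finset.sum_congr rfl fun k _ => ?_
    by_cases hk : k = i
    · subst hk
      simp [Function.comp_update, smul_comm c]
    · simp [hk, Function.comp_update, update_comm (Ne.symm hk), mul_smul]
  map_eq_zero_of_eq' w a b hab hne := by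
    have h0 : ∀ k, k ≠ a → k ≠ b → α (update (T ∘ w) k u) • P (w k) = 0 := by
      intro k ha hb
      rw [α.map_eq_zero_of_eq _ (i := a) (j := b) ?_ hne, zero_smul]
      simp [Ne.symm ha, Ne.symm hb, hab]
    rw [← Finset.sum_subset (Finset.subset_univ {a, b}) (fun k _ hk => by
      simp only [Finset.mem_insert, Finset.mem_singleton, not_or] at hk
      exact h0 k hk.1 hk.2), Finset.sum_pair hne]
    have h1 : update (T ∘ w) b u = update (T ∘ w) a u ∘ Equiv.swap a b := by
      ext k
      by_cases ha : k = a
      · subst ha; simp [hne, hne.symm, hab]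
      · by_cases hb : k = b
        · subst hb; simp
        · simp [Equiv.swap_apply_of_ne_of_ne ha hb, ha, hb]
    rw [h1, α.map_swap _ hne, hab]
    simp

open Function in
theorem insertSum_apply {ι V B F : Type*} [Fintype ι] [DecidableEq ι]
    [AddCommGroup V] [Module ℝ V] [AddCommGroup B] [Module ℝ B] [AddCommGroup F] [Module ℝ F]
    (α : B [⋀^ι]→ₗ[ℝ] ℝ) (T : V →ₗ[ℝ] B) (P : V →ₗ[ℝ] F) (u : B) (w : ι → V) :
    insertSum α T P u w = ∑ i, α (update (T ∘ w) i u) • P (w i) := rfl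

theorem continuous_alternatingMap {k : ℕ} {V : Type*} [AddCommGroup V] [Module ℝ V]
    [TopologicalSpace V] [IsTopologicalAddGroup V] [ContinuousSMul ℝ V] [T2Space V]
    [FiniteDimensional ℝ V] (f : V [⋀^Fin k]→ₗ[ℝ] ℝ) : Continuous f := by
  let b := Module.finBasis ℝ V
  have h : ∀ w : Fin k → V, f w = ∑ r : Fin k → Fin (Module.finrank ℝ V),
      (∏ i, b.coord (r i) (w i)) • f (fun i => b (r i)) := by
    intro w
    have hw : w = fun i => ∑ l, b.coord l (w i) • b l := by
      ext i
      simp [b.sum_repr]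
    conv_lhs => rw [hw]
    have := f.toMultilinearMap.map_sum (fun (i : Fin k) l => b.coord l (w i) • b l)
    refine this.trans (Finset.sum_congr rfl fun r _ => ?_)
    exact f.toMultilinearMap.map_smul_univ _ _
  have h' : (f : (Fin k → V) → ℝ) = fun w => ∑ r : Fin k → Fin (Module.finrank ℝ V),
      (∏ i, b.coord (r i) (w i)) • f (fun i => b (r i)) := funext h
  rw [h']
  refine continuous_finsetSum _ fun r _ => ?_
  have h2 : Continuous fun w : Fin k → V => ∏ i, b.coord (r i) (w i) :=
    continuous_finsetProd _ fun i _ =>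
      (b.coord (r i)).continuous_of_finiteDimensional.comp (continuous_apply i)
  exact h2.mul continuous_const

end Multilinear

section Forms

variable {k : ℕ} {V X : Type*} [NormedAddCommGroup V] [NormedSpace ℝ V]
  [TopologicalSpace X] [ChartedSpace V X]

/-- The exterior derivative of a differential `k`-form `Φ` on a manifold: at `x` it is computed in the
preferred chart at `x`. -/
def extDerivManifold (Φ : ∀ x : X, TangentSpace 𝓘(ℝ, V) x [⋀^Fin k]→L[ℝ] ℝ) (x : X) :
    TangentSpace 𝓘(ℝ, V) x [⋀^Fin (k + 1)]→L[ℝ] ℝ :=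
  (extDeriv (fun z : V => (Φ ((chartAt V x).symm z)).compContinuousLinearMap
      (mfderiv 𝓘(ℝ, V) 𝓘(ℝ, V) (chartAt V x).symm z)) (chartAt V x x)).compContinuousLinearMap
    (chartDeriv (chartAt V x) x)

variable [FiniteDimensional ℝ V]

/-- An alternating form on a (finite-dimensional) tangent space is continuous. -/
def toContinuousForm {x : X} (f : TangentSpace 𝓘(ℝ, V) x [⋀^Fin k]→ₗ[ℝ] ℝ) :
    TangentSpace 𝓘(ℝ, V) x [⋀^Fin k]→L[ℝ] ℝ :=
  { f with
    cont := by
      have : T2Space (TangentSpace 𝓘(ℝ, V) x) := inferInstanceAs (T2Space V)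
      have : FiniteDimensional ℝ (TangentSpace 𝓘(ℝ, V) x) := inferInstanceAs (FiniteDimensional ℝ V)
      exact continuous_alternatingMap f }

end Forms

section Lagrangian

variable {m n : ℕ} {M E : Type*}
  [TopologicalSpace M] [ChartedSpace (BaseModel m) M]
  [TopologicalSpace E] [ChartedSpace (TotModel m n) E] {π : E → M}

/-- The model of `J¹π`. -/
abbrev JetModel (m n : ℕ) := TotModel m n × JetFib m n
/-- The model of `J¹π*`. -/
abbrev MomModel (m n : ℕ) := TotModel m n × MomFib m n

/-- Differential `m`-forms on `M`, without regularity. -/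
abbrev BaseForm (m : ℕ) (M : Type*) [TopologicalSpace M] [ChartedSpace (BaseModel m) M] :=
  ∀ x : M, TangentSpace 𝓘(ℝ, BaseModel m) x [⋀^Fin m]→L[ℝ] ℝ

/-- The coefficient of `η` in the chart `e`: `η = density η e · dx¹ ∧ … ∧ dxᵐ` in the chart `e`. -/
def density (η : BaseForm m M) (e : OpenPartialHomeomorph M (BaseModel m)) (x : BaseModel m) : ℝ :=
  η (e.symm x) fun i => (chartDeriv e (e.symm x)).inverse (EuclideanSpace.single i 1)

/-- A volume form on `M`: a smooth nowhere vanishing `m`-form. -/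
structure IsVolumeForm (η : BaseForm m M) : Prop where
  ne_zero : ∀ x, η x ≠ 0
  smooth : ∀ e ∈ IsManifold.maximalAtlas 𝓘(ℝ, BaseModel m) ∞ M,
    ContDiffOn ℝ ∞ (density η e) e.target

namespace Jet

/-- The vertical part `w - hor (Tπ w)` of a tangent vector to `E`, with respect to the jet `j`; in
coordinates `(d y^A - v^A_α d x^α) ∂/∂y^A`. -/
def vert (j : Jet m n π) : TangentSpace 𝓘(ℝ, TotModel m n) j.pt →L[ℝ]
    TangentSpace 𝓘(ℝ, TotModel m n) j.pt :=
  ContinuousLinearMap.id ℝ _ - j.hor.comp (dproj m n π j.pt)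

theorem dproj_vert (j : Jet m n π) (w : TangentSpace 𝓘(ℝ, TotModel m n) j.pt) :
    dproj m n π j.pt (j.vert w) = 0 := by
  have := DFunLike.congr_fun j.dproj_comp_hor (dproj m n π j.pt w)
  simp only [ContinuousLinearMap.comp_apply] at this
  simp [vert, this]

/-- The affine action of `Hom (T_{π y} M, V_y π)` on the fibre of `J¹π`. -/
def shift (j : Jet m n π) (A : VertHom m n π j.pt) : Jet m n π where
  pt := j.pt
  hor := j.hor + A
  dproj_comp_hor := by
    rw [ContinuousLinearMap.comp_add, j.dproj_comp_hor, (VertHom.mem_iff _).1 A.2, add_zero]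

/-- The fibre derivative of `L : J¹π → ℝ` at `j`; in coordinates `∂L/∂v^A_α`. -/
def fibreDeriv (L : Jet m n π → ℝ) (j : Jet m n π) : Module.Dual ℝ (VertHom m n π j.pt) :=
  (fderiv ℝ (fun A : VertHom m n π j.pt => L (j.shift A)) 0).toLinearMap

/-- The vertical endomorphism at `j`, as a form on `T_y E` with values in the vertical space
`Hom (T_{π y} M, V_y π)` of `J¹π → E` (its value on vectors of `T_j J¹π` is `Jet.vertEndo`). With
`η = dx¹ ∧ … ∧ dxᵐ` it is
`(d y^A - v^A_α d x^α) ∧ i(∂/∂x^β) η ⊗ ∂/∂v^A_β`: its value on `w` sends `u` to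
`∑ i, η (Tπ w₁, …, u, …, Tπ w_m) • vert (w i)`, with `u` in the `i`-th slot. -/
def vertForm (η : BaseForm m M) (j : Jet m n π) :
    TangentSpace 𝓘(ℝ, TotModel m n) j.pt [⋀^Fin m]→ₗ[ℝ] VertHom m n π j.pt where
  toFun w := ∑ i, ⟨((η (π j.pt)).toContinuousLinearMap (fun k => dproj m n π j.pt (w k)) i).smulRight
      (j.vert (w i)), by
        rw [VertHom.mem_iff]
        ext u
        simp [j.dproj_vert]⟩
  map_update_add' {inst} w i x y := by
    cases Subsingleton.elim inst (instDecidableEqFin m)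
    ext u
    have h := (insertSum (η (π j.pt)).toAlternatingMap (dproj m n π j.pt).toLinearMap
      j.vert.toLinearMap u).map_update_add w i x y
    simp only [insertSum_apply] at h
    simpa using! h
  map_update_smul' {inst} w i c x := by
    cases Subsingleton.elim inst (instDecidableEqFin m)
    ext u
    have h := (insertSum (η (π j.pt)).toAlternatingMap (dproj m n π j.pt).toLinearMap
      j.vert.toLinearMap u).map_update_smul w i c x
    simp only [insertSum_apply] at h
    simpa using! h
  map_eq_zero_of_eq' w a b hab hne := by
    ext u
    simpa using! (insertSum (η (π j.pt)).toAlternatingMap (dproj m n π j.pt).toLinearMap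
      j.vert.toLinearMap u).map_eq_zero_of_eq w hab hne

end Jet

end Lagrangian

section Submanifolds

variable {V X : Type*} [NormedAddCommGroup V] [NormedSpace ℝ V]
  [TopologicalSpace X] [ChartedSpace V X]

/-- `S` is an embedded (regular) submanifold: near each of its points it is, in a suitable chart, a
linear subspace of the model. -/
def IsEmbeddedSubmanifold (V : Type*) {X : Type*} [NormedAddCommGroup V] [NormedSpace ℝ V]
    [TopologicalSpace X] [ChartedSpace V X] (S : Set X) : Prop :=
  ∀ x ∈ S, ∃ e ∈ IsManifold.maximalAtlas 𝓘(ℝ, V) ∞ X, x ∈ e.source ∧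
    ∃ W : Submodule ℝ V, ∀ y ∈ e.source, y ∈ S ↔ e y ∈ W

/-- The tangent space of `S` at `x`, spanned by the velocities at `x` of smooth curves in `S`. -/
def tangentTo (S : Set X) (x : X) : Submodule ℝ (TangentSpace 𝓘(ℝ, V) x) :=
  Submodule.span ℝ {v | ∃ γ : ℝ → X, ContMDiffAt 𝓘(ℝ, ℝ) 𝓘(ℝ, V) ∞ γ 0 ∧
    (∀ᶠ t in 𝓝 (0 : ℝ), γ t ∈ S) ∧
    (⟨γ 0, mfderiv 𝓘(ℝ, ℝ) 𝓘(ℝ, V) γ 0 (1 : ℝ)⟩ : TangentBundle 𝓘(ℝ, V) X) = ⟨x, v⟩}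

end Submanifolds

section MultiVectors

variable {m : ℕ} {V X : Type*} [NormedAddCommGroup V] [NormedSpace ℝ V]
  [TopologicalSpace X] [ChartedSpace V X]

/-- Fields of `m`-vectors on `X`, without regularity. Fields on a subset `S` are described by fields on
`X` of which only the values at the points of `S` are used. -/
abbrev MultiVectorField (m : ℕ) (V X : Type*) [NormedAddCommGroup V] [NormedSpace ℝ V]
    [TopologicalSpace X] [ChartedSpace V X] :=
  ∀ x : X, ⋀[ℝ]^m (TangentSpace 𝓘(ℝ, V) x)

/-- The contraction of an `m`-vector with an alternating `m`-form; on `Y₁ ∧ … ∧ Y_m` it is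
`α (Y₁, …, Y_m)`. -/
def contract {W F : Type*} [AddCommGroup W] [Module ℝ W] [AddCommGroup F] [Module ℝ F]
    (α : W [⋀^Fin m]→ₗ[ℝ] F) (𝒳 : ⋀[ℝ]^m W) : F :=
  exteriorPower.alternatingMapLinearEquiv α 𝒳

/-- On `U ∩ S` the field `𝒳` is `Y₁ ∧ … ∧ Y_m` for vector fields `Y_i` that are smooth on `U` and
tangent to `S` along `S`. -/
structure IsDecompositionOn [IsManifold 𝓘(ℝ, V) ∞ X] (S U : Set X)
    (𝒳 : MultiVectorField m V X)
    (Y : Fin m → ∀ x : X, TangentSpace 𝓘(ℝ, V) x) : Prop where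
  isOpen : IsOpen U
  smooth : ∀ i, ContMDiffOn 𝓘(ℝ, V) (𝓘(ℝ, V).prod 𝓘(ℝ, V)) ∞
    (fun x => (⟨x, Y i x⟩ : TangentBundle 𝓘(ℝ, V) X)) U
  tangent : ∀ x ∈ S ∩ U, ∀ i, Y i x ∈ tangentTo S x
  eq_wedge : ∀ x ∈ S ∩ U, 𝒳 x = exteriorPower.ιMulti ℝ m fun i => Y i x

/-- `𝒳` is a (smooth) locally decomposable `m`-vector field on the submanifold `S`. -/
def IsLocallyDecomposableOn [IsManifold 𝓘(ℝ, V) ∞ X] (S : Set X)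
    (𝒳 : MultiVectorField m V X) : Prop :=
  ∀ x ∈ S, ∃ U, x ∈ U ∧ ∃ Y, IsDecompositionOn S U 𝒳 Y

/-- The points of `S` at which the distribution spanned by `𝒳 = Y₁ ∧ … ∧ Y_m` is involutive. -/
def involutivitySet [IsManifold 𝓘(ℝ, V) ∞ X] (S : Set X)
    (𝒳 : MultiVectorField m V X) : Set X :=
  {x ∈ S | ∃ U, x ∈ U ∧ ∃ Y, IsDecompositionOn S U 𝒳 Y ∧ ∀ μ ν,
    VectorField.mlieBracket 𝓘(ℝ, V) (Y μ) (Y ν) x ∈ Submodule.span ℝ (range fun ρ => Y ρ x)}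

/-- The integrability algorithm for `𝒳` on `S`; the index starts at the involutivity set. -/
def integrabilitySet [IsManifold 𝓘(ℝ, V) ∞ X] (S : Set X)
    (𝒳 : MultiVectorField m V X) : ℕ → Set X
  | 0 => involutivitySet S 𝒳
  | i + 1 => {x ∈ integrabilitySet S 𝒳 i |
      𝒳 x ∈ LinearMap.range (exteriorPower.map m (tangentTo (integrabilitySet S 𝒳 i) x).subtype)}

/-- `I` is the final submanifold of the integrability algorithm, all of whose steps are submanifolds. -/
structure IsFinalIntegrabilitySubmanifold [IsManifold 𝓘(ℝ, V) ∞ X] (S : Set X)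
    (𝒳 : MultiVectorField m V X) (I : Set X) : Prop where
  submanifold : ∀ i, IsEmbeddedSubmanifold V (integrabilitySet S 𝒳 i)
  stable : ∃ i, integrabilitySet S 𝒳 (i + 1) = integrabilitySet S 𝒳 i ∧ I = integrabilitySet S 𝒳 i

end MultiVectors

section FieldEquations

variable {m n : ℕ} {M E : Type*}
  [TopologicalSpace M] [ChartedSpace (BaseModel m) M]
  [TopologicalSpace E] [ChartedSpace (TotModel m n) E] [IsManifold 𝓘(ℝ, TotModel m n) ∞ E]
  {π : E → M} [hπ : IsFibredManifold m n π]

namespace Jet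

/-- The differential of `J¹π → E`. -/
abbrev dpt (j : Jet m n π) : TangentSpace 𝓘(ℝ, JetModel m n) j →L[ℝ]
    TangentSpace 𝓘(ℝ, TotModel m n) j.pt :=
  mfderiv 𝓘(ℝ, JetModel m n) 𝓘(ℝ, TotModel m n) (Jet.pt : Jet m n π → E) j

/-- The differential of `J¹π → M`. -/
def dbase (j : Jet m n π) : TangentSpace 𝓘(ℝ, JetModel m n) j →L[ℝ]
    TangentSpace 𝓘(ℝ, BaseModel m) (π j.pt) :=
  (dproj m n π j.pt).comp j.dpt

/-- The pull-back `ω` of the volume form `η` to `J¹π`. -/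
def volume (η : BaseForm m M) (j : Jet m n π) :
    TangentSpace 𝓘(ℝ, JetModel m n) j [⋀^Fin m]→ₗ[ℝ] ℝ :=
  (η (π j.pt)).toAlternatingMap.compLinearMap j.dbase.toLinearMap

/-- The vertical endomorphism of `J¹π`, a semi-basic `m`-form with values in the vertical bundle of
`J¹π → E`. -/
def vertEndo (η : BaseForm m M) (j : Jet m n π) :
    TangentSpace 𝓘(ℝ, JetModel m n) j [⋀^Fin m]→ₗ[ℝ] VertHom m n π j.pt :=
  (j.vertForm η).compLinearMap j.dpt.toLinearMap

end Jet

/-- The Poincaré–Cartan `m`-form `i(V) 𝓛 + 𝓛` of the Lagrangian density `𝓛 = L ω`; in coordinates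
`∂L/∂v^A_α (d y^A - v^A_β d x^β) ∧ i(∂/∂x^α) ω + L ω`. -/
def poincareCartan (η : BaseForm m M) (L : Jet m n π → ℝ) (j : Jet m n π) :
    TangentSpace 𝓘(ℝ, JetModel m n) j [⋀^Fin m]→L[ℝ] ℝ :=
  toContinuousForm ((j.fibreDeriv L).compAlternatingMap (j.vertEndo η) + L j • j.volume η)

/-- The Poincaré–Cartan `(m + 1)`-form, minus the exterior derivative of the `m`-form. -/
def poincareCartanExt (η : BaseForm m M) (L : Jet m n π → ℝ) (j : Jet m n π) :
    TangentSpace 𝓘(ℝ, JetModel m n) j [⋀^Fin (m + 1)]→L[ℝ] ℝ :=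
  -extDerivManifold (poincareCartan η L) j

/-- The restricted Legendre map `J¹π → J¹π*`; in coordinates `p^α_A = ∂L/∂v^A_α`. -/
def legendre (L : Jet m n π → ℝ) (j : Jet m n π) : Momentum m n π := ⟨j.pt, j.fibreDeriv L⟩

/-- The differential of the Legendre map. -/
def dlegendre (L : Jet m n π → ℝ) (j : Jet m n π) : TangentSpace 𝓘(ℝ, JetModel m n) j →L[ℝ]
    TangentSpace 𝓘(ℝ, MomModel m n) (legendre L j) :=
  mfderiv 𝓘(ℝ, JetModel m n) 𝓘(ℝ, MomModel m n) (legendre L) j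

/-- `L` is almost-regular: the image of the Legendre map is a closed submanifold, the Legendre map is a
submersion onto it, and its fibres are connected submanifolds. -/
structure IsAlmostRegular (L : Jet m n π → ℝ) : Prop where
  isClosed_range : IsClosed (range (legendre L))
  submanifold_range : IsEmbeddedSubmanifold (MomModel m n) (range (legendre L))
  submersion : ∀ j, LinearMap.range (dlegendre L j).toLinearMap =
    tangentTo (range (legendre L)) (legendre L j)
  fibre_connected : ∀ j, IsConnected (legendre L ⁻¹' {legendre L j})
  fibre_submanifold : ∀ j, IsEmbeddedSubmanifold (JetModel m n) (legendre L ⁻¹' {legendre L j})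

/-- The constraint algorithm: the set number `i + 1` consists of the points `j` of the set number `i`
at which there is a transverse `h : T M → T_j J¹π`, with values in the tangent space of the set
number `i`, that solves `Ω (h u₁, …, h u_m, w) = 0` for all `u` and `w`. -/
def constraintSet (η : BaseForm m M) (L : Jet m n π → ℝ) : ℕ → Set (Jet m n π)
  | 0 => univ
  | i + 1 => {j ∈ constraintSet η L i |
      ∃ h : TangentSpace 𝓘(ℝ, BaseModel m) (π j.pt) →ₗ[ℝ] TangentSpace 𝓘(ℝ, JetModel m n) j,
        (∀ u, h u ∈ tangentTo (constraintSet η L i) j) ∧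
        (∀ u, j.dbase (h u) = u) ∧
        ∀ (u : Fin m → TangentSpace 𝓘(ℝ, BaseModel m) (π j.pt)) (w : TangentSpace 𝓘(ℝ, JetModel m n) j),
          (poincareCartanExt η L j).toAlternatingMap.curryLeft w (fun i => h (u i)) = 0}

/-- `N` is the final constraint submanifold, and all steps of the algorithm are submanifolds. -/
structure IsFinalConstraintSubmanifold (η : BaseForm m M) (L : Jet m n π → ℝ)
    (N : Set (Jet m n π)) : Prop where
  submanifold : ∀ i, IsEmbeddedSubmanifold (JetModel m n) (constraintSet η L i)
  stable : ∃ k, 0 < k ∧ constraintSet η L (k + 1) = constraintSet η L k ∧ N = constraintSet η L k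

/-- `𝒳` is a locally decomposable `m`-vector field on `N` with `i(𝒳) ω = 1` and `i(𝒳) Ω = 0`. -/
structure IsSolutionOn (η : BaseForm m M) (L : Jet m n π → ℝ) (N : Set (Jet m n π))
    (𝒳 : MultiVectorField m (JetModel m n) (Jet m n π)) : Prop where
  decomposable : IsLocallyDecomposableOn N 𝒳
  transverse : ∀ j ∈ N, contract (j.volume η) (𝒳 j) = 1
  field_eq : ∀ j ∈ N, ∀ w,
    contract ((poincareCartanExt η L j).toAlternatingMap.curryLeft w) (𝒳 j) = 0

/-- The map `Λᵐ T_j FL` on `m`-vectors. -/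
def pushforward (L : Jet m n π → ℝ) (j : Jet m n π) :
    ⋀[ℝ]^m (TangentSpace 𝓘(ℝ, JetModel m n) j) →ₗ[ℝ]
      ⋀[ℝ]^m (TangentSpace 𝓘(ℝ, MomModel m n) (legendre L j)) :=
  exteriorPower.map m (dlegendre L j).toLinearMap

/-- The `m`-vector field `𝒳` on `N` projects onto the `m`-vector field `𝒴` on `P = FL (N)`. -/
def IsProjectableOnto (L : Jet m n π → ℝ) (N : Set (Jet m n π))
    (𝒳 : MultiVectorField m (JetModel m n) (Jet m n π))
    (𝒴 : MultiVectorField m (MomModel m n) (Momentum m n π)) : Prop :=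
  ∀ j ∈ N, pushforward L j (𝒳 j) = 𝒴 (legendre L j)

/-- The points of `N` at which `i(𝒳) V = 0`. -/
def semiHolonomicSet (η : BaseForm m M) (N : Set (Jet m n π))
    (𝒳 : MultiVectorField m (JetModel m n) (Jet m n π)) : Set (Jet m n π) :=
  {j ∈ N | contract (j.vertEndo η) (𝒳 j) = 0}

/-- `σ` is a smooth section of the Legendre map over `P = FL (N)` with image `S`. -/
structure IsSectionOnto (L : Jet m n π → ℝ) (N S : Set (Jet m n π))
    (σ : Momentum m n π → Jet m n π) : Prop where
  smooth : ContMDiffOn 𝓘(ℝ, MomModel m n) 𝓘(ℝ, JetModel m n) ∞ σ (legendre L '' N)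
  legendre_apply : ∀ p ∈ legendre L '' N, legendre L (σ p) = p
  image_eq : σ '' (legendre L '' N) = S

/-- The `m`-vector field `𝒳` on `S = σ (P)` is the image `Λᵐ Tσ ∘ 𝒴` of the `m`-vector field `𝒴` on
`P = FL (N)`. -/
def IsImageUnder (L : Jet m n π → ℝ) (N : Set (Jet m n π)) (σ : Momentum m n π → Jet m n π)
    (𝒴 : MultiVectorField m (MomModel m n) (Momentum m n π))
    (𝒳 : MultiVectorField m (JetModel m n) (Jet m n π)) : Prop :=
  ∀ p ∈ legendre L '' N, 𝒳 (σ p) = exteriorPower.map m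
    (mfderivWithin 𝓘(ℝ, MomModel m n) 𝓘(ℝ, JetModel m n) σ (legendre L '' N) p).toLinearMap (𝒴 p)

/-- `s : U → I` is a smooth integral section of `𝒳`: a section of `J¹π → M` such that the tangent
`m`-vectors of its image are the multiples of `𝒳`. -/
structure IsIntegralSection (I : Set (Jet m n π))
    (𝒳 : MultiVectorField m (JetModel m n) (Jet m n π))
    (U : Set M) (s : M → Jet m n π) : Prop where
  smooth : ContMDiffOn 𝓘(ℝ, BaseModel m) 𝓘(ℝ, JetModel m n) ∞ s U
  isSection : ∀ x ∈ U, π (s x).pt = x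
  mem : ∀ x ∈ U, s x ∈ I
  tangent : ∀ x ∈ U, LinearMap.range (exteriorPower.map m
    (mfderiv 𝓘(ℝ, BaseModel m) 𝓘(ℝ, JetModel m n) s x).toLinearMap) = Submodule.span ℝ {𝒳 (s x)}

/-- `j` is the `1`-jet of `φ` at the base point `x` of `j`: `φ x` is the point of `E` under `j`, and
`T_x φ` is the linear map `j`. -/
def Jet.IsJetOf (j : Jet m n π) (φ : M → E) : Prop :=
  ∀ u : TangentSpace 𝓘(ℝ, BaseModel m) (π j.pt),
    (⟨j.pt, j.hor u⟩ : TangentBundle 𝓘(ℝ, TotModel m n) E) =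
      ⟨φ (π j.pt), mfderiv 𝓘(ℝ, BaseModel m) 𝓘(ℝ, TotModel m n) φ (π j.pt) u⟩

open Classical in
/-- The coordinate expression `L̂ (x, y, v)` of the Lagrangian density, `𝓛 = L̂ dx¹ ∧ … ∧ dxᵐ`, in the
adapted chart `a`. -/
def localLagrangian (η : BaseForm m M) (L : Jet m n π → ℝ) (a : AdaptedChart m n π)
    (z : TotModel m n × JetFib m n) : ℝ :=
  if h : z.1 ∈ a.tot.target then
    L ((jetCoords hπ).glue a (a.tot.symm z.1) (a.tot.map_target h) z.2) * density η a.base z.1.1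
  else 0

/-- The functions `y^A = φ^A (x)`. -/
def localSection (a : AdaptedChart m n π) (φ : M → E) (x : BaseModel m) : FibModel n :=
  (a.tot (φ (a.base.symm x))).2

/-- The coordinates `(x, φ (x), ∂φ/∂x (x))` of the `1`-jet of `φ`. -/
def localProlongation (a : AdaptedChart m n π) (φ : M → E) (x : BaseModel m) :
    TotModel m n × JetFib m n :=
  ((x, localSection a φ x), fderiv ℝ (localSection a φ) x)

/-- The section `φ` satisfies on `U` the Euler–Lagrange equations, in every adapted chart:
`∂L̂/∂y^A (j¹φ) = ∑ α, d/dx^α (∂L̂/∂v^A_α (j¹φ))` for all `A`. -/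
def SolvesEulerLagrange (η : BaseForm m M) (L : Jet m n π → ℝ) (U : Set M) (φ : M → E) : Prop :=
  ∀ (a : AdaptedChart m n π), ∀ x ∈ a.base.target, a.base.symm x ∈ U →
    φ (a.base.symm x) ∈ a.tot.source → ∀ A : Fin n,
      fderiv ℝ (localLagrangian η L a) (localProlongation a φ x)
          ((0, EuclideanSpace.single A 1), 0) =
        ∑ α : Fin m, fderiv ℝ (fun x' =>
          fderiv ℝ (localLagrangian η L a) (localProlongation a φ x')
            (0, (EuclideanSpace.proj α).smulRight (EuclideanSpace.single A 1)))
          x (EuclideanSpace.single α 1)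

end FieldEquations

end FieldTheory

end

open FieldTheory

/-!
The restricted Legendre map is over `E`, and a vector `v` killed by its differential changes only
the velocities `v^A_α`, along a direction annihilated by the Hessian `∂²L/∂v∂v`. Hence `𝒱` and
`Ω_𝓛` vanish as soon as one of their arguments is such a `v`, so that the contractions of an
`m`-vector with `𝒱` and with `Ω_𝓛` depend only on its image under the Legendre map. Since
`𝒳^{S_f}` is the image of `𝒳^{P_f}` under a section of the Legendre map, `𝒳^{S_f}` and `𝒳^{N_f}`
have the same image at every point of `S_f`, and `𝒳^{S_f}` inherits `i(𝒳)Ω_𝓛 = 0` and `i(𝒳)𝒱 = 0`.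

Along an integral section `s` the second equation says that the tangent vectors of `s` are
annihilated by the contact forms `dy^A - v^A_α dx^α`, so that `s` is the prolongation of its
projection `φ`. The first one, evaluated on `∂/∂y^A` and the tangent vectors of `s`, is then the
Euler–Lagrange equation.
-/

namespace FieldTheory

noncomputable section

section ChartExpressions

variable {V V' X X' : Type*} [NormedAddCommGroup V] [NormedSpace ℝ V]
  [NormedAddCommGroup V'] [NormedSpace ℝ V']
  [TopologicalSpace X] [ChartedSpace V X] [TopologicalSpace X'] [ChartedSpace V' X']
  {e : OpenPartialHomeomorph X V} {e' : OpenPartialHomeomorph X' V'} {f : X → X'} {x : X}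

theorem contMDiffAt_of_eventually_chart_eq (he : e ∈ IsManifold.maximalAtlas 𝓘(ℝ, V) ∞ X)
    (he' : e' ∈ IsManifold.maximalAtlas 𝓘(ℝ, V') ∞ X') {F : V → V'} (hx : x ∈ e.source)
    (hf : ∀ᶠ y in 𝓝 x, f y ∈ e'.source ∧ e' (f y) = F (e y)) (hF : ContDiffAt ℝ ∞ F (e x)) :
    ContMDiffAt 𝓘(ℝ, V) 𝓘(ℝ, V') ∞ f x := by
  obtain ⟨hfx, hfFx⟩ := hf.self_of_nhds
  have hFe : ContMDiffAt 𝓘(ℝ, V) 𝓘(ℝ, V') ∞ (F ∘ e) x :=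
    hF.contMDiffAt.comp x
      ((contMDiffOn_of_mem_maximalAtlas he).contMDiffAt (e.open_source.mem_nhds hx))
  have hsymm : ContMDiffAt 𝓘(ℝ, V') 𝓘(ℝ, V') ∞ e'.symm (F (e x)) :=
    (contMDiffOn_symm_of_mem_maximalAtlas he').contMDiffAt
      (e'.open_target.mem_nhds (hfFx ▸ e'.map_source hfx))
  refine (hsymm.comp x hFe).congr_of_eventuallyEq ?_
  filter_upwards [hf] with y hy
  simp [← hy.2, e'.left_inv hy.1]

theorem chartDeriv_comp_mfderiv (he : e ∈ IsManifold.maximalAtlas 𝓘(ℝ, V) ∞ X)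
    (he' : e' ∈ IsManifold.maximalAtlas 𝓘(ℝ, V') ∞ X') {F : V → V'}
    (hx : x ∈ e.source) (hx' : f x ∈ e'.source) (hf : ∀ᶠ y in 𝓝 x, e' (f y) = F (e y))
    (hd : MDifferentiableAt 𝓘(ℝ, V) 𝓘(ℝ, V') f x) (hF : DifferentiableAt ℝ F (e x)) :
    (chartDeriv e' (f x)).comp (mfderiv 𝓘(ℝ, V) 𝓘(ℝ, V') f x) =
      (fderiv ℝ F (e x)).comp (chartDeriv e x) := by
  have hleft := (((chart_mdifferentiable he').mdifferentiableAt hx').hasMFDerivAt).comp x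
    hd.hasMFDerivAt
  have hright := (hF.hasFDerivAt.hasMFDerivAt).comp x
    ((chart_mdifferentiable he).mdifferentiableAt hx).hasMFDerivAt
  exact hasMFDerivAt_unique hleft (hright.congr_of_eventuallyEq hf)

theorem differentiableAt_chart_comp (he : e ∈ IsManifold.maximalAtlas 𝓘(ℝ, V) ∞ X)
    (he' : e' ∈ IsManifold.maximalAtlas 𝓘(ℝ, V') ∞ X') (hx : x ∈ e.source)
    (hx' : f x ∈ e'.source) (hd : MDifferentiableAt 𝓘(ℝ, V) 𝓘(ℝ, V') f x) :
    DifferentiableAt ℝ (e' ∘ f ∘ e.symm) (e x) := by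
  rw [← e.left_inv hx] at hd
  have hfe : MDifferentiableAt 𝓘(ℝ, V) 𝓘(ℝ, V') (f ∘ e.symm) (e x) :=
    hd.comp (e x) ((chart_mdifferentiable he).mdifferentiableAt_symm (e.map_source hx))
  refine mdifferentiableAt_iff_differentiableAt.1 (MDifferentiableAt.comp (e x) ?_ hfe)
  exact (chart_mdifferentiable he').mdifferentiableAt (by simpa [e.left_inv hx] using hx')

theorem chartDeriv_mfderiv_apply (he : e ∈ IsManifold.maximalAtlas 𝓘(ℝ, V) ∞ X)
    (he' : e' ∈ IsManifold.maximalAtlas 𝓘(ℝ, V') ∞ X') (hx : x ∈ e.source)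
    (hx' : f x ∈ e'.source) (hd : MDifferentiableAt 𝓘(ℝ, V) 𝓘(ℝ, V') f x)
    (v : TangentSpace 𝓘(ℝ, V) x) :
    chartDeriv e' (f x) (mfderiv 𝓘(ℝ, V) 𝓘(ℝ, V') f x v) =
      fderiv ℝ (e' ∘ f ∘ e.symm) (e x) (chartDeriv e x v) := by
  refine DFunLike.congr_fun (chartDeriv_comp_mfderiv he he' hx hx' ?_ hd
    (differentiableAt_chart_comp he he' hx hx' hd)) v
  filter_upwards [e.open_source.mem_nhds hx] with y hy
  simp [e.left_inv hy]

theorem chartDeriv_mfderiv_symm (he : e ∈ IsManifold.maximalAtlas 𝓘(ℝ, V) ∞ X) {z : V}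
    (hz : z ∈ e.target) (w : V) :
    chartDeriv e (e.symm z) (mfderiv 𝓘(ℝ, V) 𝓘(ℝ, V) e.symm z w) = w :=
  DFunLike.congr_fun ((chart_mdifferentiable he).comp_symm_deriv hz) w

theorem mfderiv_symm_chartDeriv (he : e ∈ IsManifold.maximalAtlas 𝓘(ℝ, V) ∞ X)
    (hx : x ∈ e.source) (w : TangentSpace 𝓘(ℝ, V) x) :
    mfderiv 𝓘(ℝ, V) 𝓘(ℝ, V) e.symm (e x) (chartDeriv e x w) = w :=
  DFunLike.congr_fun ((chart_mdifferentiable he).symm_comp_deriv hx) w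

end ChartExpressions

section ExteriorDerivative

variable {k : ℕ} {V X : Type*} [NormedAddCommGroup V] [NormedSpace ℝ V]
  [TopologicalSpace X] [ChartedSpace V X] {e e' : OpenPartialHomeomorph X V}

theorem differentiableAt_alternatingForm [FiniteDimensional ℝ V] {W : Type*}
    [NormedAddCommGroup W] [NormedSpace ℝ W] {f : W → V [⋀^Fin k]→L[ℝ] ℝ} {z : W}
    (h : ∀ v, DifferentiableAt ℝ (fun y => f y v) z) : DifferentiableAt ℝ f z := by
  let b := Module.finBasis ℝ V
  let evalBasis : (V [⋀^Fin k]→L[ℝ] ℝ) →ₗ[ℝ] ((Fin k → Fin (Module.finrank ℝ V)) → ℝ) :=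
    { toFun := fun g r => g fun i => b (r i)
      map_add' := fun _ _ => rfl
      map_smul' := fun _ _ => rfl }
  have evalBasis_ker : LinearMap.ker evalBasis = ⊥ := by
    refine LinearMap.ker_eq_bot.2 fun g g' hg => ?_
    have : g.toAlternatingMap = g'.toAlternatingMap :=
      b.ext_alternating fun r _ => congrFun hg r
    ext v
    exact DFunLike.congr_fun this v
  obtain ⟨g, hg⟩ := evalBasis.exists_leftInverse_of_injective evalBasis_ker
  have hf : f = fun y => LinearMap.toContinuousLinearMap g (evalBasis (f y)) :=
    funext fun y => (DFunLike.congr_fun hg (f y)).symm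
  rw [hf]
  exact (LinearMap.toContinuousLinearMap g).differentiableAt.comp z
    (differentiableAt_pi.2 fun r => h _)

/-- The coordinate expression of a form on a manifold in the chart `e`. -/
def chartForm (Φ : ∀ x : X, TangentSpace 𝓘(ℝ, V) x [⋀^Fin k]→L[ℝ] ℝ)
    (e : OpenPartialHomeomorph X V) (z : V) : V [⋀^Fin k]→L[ℝ] ℝ :=
  (Φ (e.symm z)).compContinuousLinearMap (mfderiv 𝓘(ℝ, V) 𝓘(ℝ, V) e.symm z)

theorem chartForm_transition (Φ : ∀ x : X, TangentSpace 𝓘(ℝ, V) x [⋀^Fin k]→L[ℝ] ℝ)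
    (he : e ∈ IsManifold.maximalAtlas 𝓘(ℝ, V) ∞ X)
    (he' : e' ∈ IsManifold.maximalAtlas 𝓘(ℝ, V) ∞ X) {z : V} (hz : z ∈ (e.symm ≫ₕ e').source) :
    chartForm Φ e z = (chartForm Φ e' ((e' ∘ e.symm) z)).compContinuousLinearMap
      (fderiv ℝ (e' ∘ e.symm) z) := by
  have hz1 : z ∈ e.target := by simpa using hz.1
  have hz2 : e.symm z ∈ e'.source := by simpa using hz.2
  have hfactor : ∀ w, mfderiv 𝓘(ℝ, V) 𝓘(ℝ, V) e'.symm (e' (e.symm z))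
      (fderiv ℝ (e' ∘ e.symm) z w) = mfderiv 𝓘(ℝ, V) 𝓘(ℝ, V) e.symm z w := by
    intro w
    have h := DFunLike.congr_fun (chartDeriv_transition he he' (e.map_target hz1) hz2)
      (mfderiv 𝓘(ℝ, V) 𝓘(ℝ, V) e.symm z w)
    rw [e.right_inv hz1, ContinuousLinearMap.comp_apply, chartDeriv_mfderiv_symm he hz1] at h
    exact (congrArg (mfderiv 𝓘(ℝ, V) 𝓘(ℝ, V) e'.symm (e' (e.symm z))) h.symm).trans
      (mfderiv_symm_chartDeriv he' hz2 _)
  have congr_point : ∀ x : X, x = e.symm z → ∀ T : V →L[ℝ] TangentSpace 𝓘(ℝ, V) x,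
      (∀ w, T w = mfderiv 𝓘(ℝ, V) 𝓘(ℝ, V) e.symm z w) → ∀ w,
        chartForm Φ e z w = (Φ x).compContinuousLinearMap T w := by
    rintro x rfl T hT w
    exact congrArg (Φ (e.symm z)) (funext fun i => (hT (w i)).symm)
  ext w
  exact congr_point _ (e'.left_inv hz2)
    ((mfderiv 𝓘(ℝ, V) 𝓘(ℝ, V) e'.symm (e' (e.symm z))).comp (fderiv ℝ (e' ∘ e.symm) z)) hfactor w

theorem extDerivManifold_eq [IsManifold 𝓘(ℝ, V) ∞ X]
    (Φ : ∀ x : X, TangentSpace 𝓘(ℝ, V) x [⋀^Fin k]→L[ℝ] ℝ)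
    (he : e ∈ IsManifold.maximalAtlas 𝓘(ℝ, V) ∞ X) {x : X} (hx : x ∈ e.source)
    (hd : DifferentiableAt ℝ (chartForm Φ (chartAt V x)) (chartAt V x x)) :
    extDerivManifold Φ x =
      (extDeriv (chartForm Φ e) (e x)).compContinuousLinearMap (chartDeriv e x) := by
  have hc : chartAt V x ∈ IsManifold.maximalAtlas 𝓘(ℝ, V) ∞ X :=
    IsManifold.chart_mem_maximalAtlas x
  have hxc : x ∈ (chartAt V x).source := mem_chart_source V x
  have htrans : (e.symm ≫ₕ chartAt V x).source ∈ 𝓝 (e x) :=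
    (e.symm ≫ₕ chartAt V x).open_source.mem_nhds (by simp [hx])
  have hpullback : chartForm Φ e =ᶠ[𝓝 (e x)] fun z =>
      (chartForm Φ (chartAt V x) ((chartAt V x ∘ e.symm) z)).compContinuousLinearMap
        (fderiv ℝ (chartAt V x ∘ e.symm) z) := by
    filter_upwards [htrans] with z hz using chartForm_transition Φ he hc hz
  have hpt : (chartAt V x ∘ e.symm) (e x) = chartAt V x x := by simp [e.left_inv hx]
  have hr : minSmoothness ℝ 2 ≤ (∞ : WithTop ℕ∞) := by
    simpa using! WithTop.coe_le_coe.2 (le_top : (2 : ℕ∞) ≤ ⊤)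
  rw [hpullback.extDeriv_eq, extDeriv_pullback (by rwa [hpt])
    ((contDiffOn_transition he hc).contDiffAt htrans) hr, hpt]
  ext w
  change extDeriv (chartForm Φ (chartAt V x)) (chartAt V x x) (chartDeriv (chartAt V x) x ∘ w) = _
  rw [chartDeriv_transition he hc hx hxc]
  rfl

end ExteriorDerivative

section VolumeForm

open Function

/-- The standard volume form `dx¹ ∧ … ∧ dxᵐ` of `ℝᵐ`. -/
def stdVol (m : ℕ) : BaseModel m [⋀^Fin m]→L[ℝ] ℝ :=
  { (EuclideanSpace.basisFun (Fin m) ℝ).toBasis.det with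
    cont := continuous_alternatingMap _ }

variable {m : ℕ}

theorem stdVol_apply (X : Fin m → BaseModel m) :
    stdVol m X = (EuclideanSpace.basisFun (Fin m) ℝ).toBasis.det X := rfl

theorem stdVol_eq_det (X : Fin m → BaseModel m) :
    stdVol m X = (Matrix.of fun k i => X i k).det := by
  rw [stdVol_apply, Module.Basis.det_apply]
  rfl

theorem stdVol_single : stdVol m (fun i => EuclideanSpace.single i (1 : ℝ)) = 1 := by
  rw [stdVol_apply]
  convert (EuclideanSpace.basisFun (Fin m) ℝ).toBasis.det_self using 2
  ext1 i
  simp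

theorem sum_stdVol_update_smul (X : Fin m → BaseModel m) (u : BaseModel m) :
    ∑ i, stdVol m (update X i u) • X i = stdVol m X • u := by
  have hcramer := Matrix.mulVec_cramer (Matrix.of fun k i => X i k) (fun k => u k)
  have hupdate : ∀ i, stdVol m (update X i u) =
      (Matrix.of fun k i => X i k).cramer (fun k => u k) i := by
    intro i
    rw [stdVol_eq_det, Matrix.cramer_apply]
    congr 1
    ext r c
    obtain rfl | hc := eq_or_ne c i <;> simp [*]
  ext k
  have hk := congrFun hcramer k
  simp only [Matrix.mulVec, dotProduct, Matrix.of_apply, Pi.smul_apply, ← hupdate,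
    ← stdVol_eq_det] at hk
  simpa [mul_comm] using hk

theorem stdVol_update_single (i : Fin m) (u : BaseModel m) :
    stdVol m (update (fun i => EuclideanSpace.single i (1 : ℝ)) i u) = u i := by
  have h := congrArg (fun v : BaseModel m => v i)
    (sum_stdVol_update_smul (fun i => EuclideanSpace.single i (1 : ℝ)) u)
  simpa [stdVol_single, Pi.single_apply] using h

variable {M : Type*} [TopologicalSpace M] [ChartedSpace (BaseModel m) M]
  {e : OpenPartialHomeomorph M (BaseModel m)}

theorem form_apply_eq_density_mul (η : BaseForm m M)
    (he : e ∈ IsManifold.maximalAtlas 𝓘(ℝ, BaseModel m) ∞ M) {x : M} (hx : x ∈ e.source)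
    (u : Fin m → TangentSpace 𝓘(ℝ, BaseModel m) x) :
    η x u = density η e (e x) * stdVol m fun i => chartDeriv e x (u i) := by
  have hinv := chartDeriv_isInvertible he hx
  let f : BaseModel m [⋀^Fin m]→ₗ[ℝ] ℝ :=
    (η x).toAlternatingMap.compLinearMap (chartDeriv e x).inverse.toLinearMap
  have hf : ∀ u, f (fun i => chartDeriv e x (u i)) = η x u := fun u =>
    congrArg (η x) (funext fun i => hinv.inverse_apply_eq.2 rfl)
  have hdensity : density η e (e x) = f fun i => EuclideanSpace.single i 1 := by
    rw [density, e.left_inv hx]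
    rfl
  have hdet := DFunLike.congr_fun (f.eq_smul_basis_det (EuclideanSpace.basisFun (Fin m) ℝ).toBasis)
    fun i => chartDeriv e x (u i)
  have hbasis : ⇑(EuclideanSpace.basisFun (Fin m) ℝ).toBasis =
      fun i => EuclideanSpace.single i (1 : ℝ) := by
    ext1 i
    simp
  rw [← hf, hdet, hdensity, stdVol_apply, hbasis, AlternatingMap.smul_apply, smul_eq_mul]

theorem density_ne_zero {η : BaseForm m M} (hη : ∀ x, η x ≠ 0)
    (he : e ∈ IsManifold.maximalAtlas 𝓘(ℝ, BaseModel m) ∞ M) {x : M} (hx : x ∈ e.source) :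
    density η e (e x) ≠ 0 := fun h =>
  hη x (ContinuousAlternatingMap.ext fun u => by
    rw [form_apply_eq_density_mul η he hx u, h, zero_mul]
    rfl)

end VolumeForm

section Calculus

variable {X : Type*} [NormedAddCommGroup X] [NormedSpace ℝ X]

theorem hasFDerivAt_fderiv_apply {f : X → ℝ} {z : X} (hf : ContDiffAt ℝ 2 f z) (w : X) :
    HasFDerivAt (fun y => fderiv ℝ f y w) ((fderiv ℝ (fderiv ℝ f) z).flip w) z := by
  have hf' : HasFDerivAt (fderiv ℝ f) (fderiv ℝ (fderiv ℝ f) z) z :=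
    ((hf.fderiv_right (m := 1) le_rfl).differentiableAt (by simp)).hasFDerivAt
  refine (hf'.clm_apply (hasFDerivAt_const w z)).congr_fderiv ?_
  ext v
  simp

end Calculus

section LocalForm

open Function

variable {m n : ℕ}

/-- `dy ∧ i(∂/∂x^α) (dx¹ ∧ … ∧ dxᵐ) ⊗ ∂/∂v_α` on `m` vectors with `x`-parts `X i` and `y`-parts
`Y i`. -/
def wedgeInterior (X : Fin m → BaseModel m) : (Fin m → FibModel n) →ₗ[ℝ] JetFib m n where
  toFun Y := ∑ i, ((stdVol m).toContinuousLinearMap X i).smulRight (Y i)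
  map_add' Y Y' := by
    ext1 u
    simp [Finset.sum_add_distrib]
  map_smul' r Y := by
    ext1 u
    simp [Finset.smul_sum, smul_comm r]

theorem wedgeInterior_apply (X : Fin m → BaseModel m) (Y : Fin m → FibModel n)
    (u : BaseModel m) : wedgeInterior X Y u = ∑ i, stdVol m (update X i u) • Y i := by
  simp [wedgeInterior]

theorem wedgeInterior_comp (X : Fin m → BaseModel m) (v : JetFib m n) :
    wedgeInterior X (fun i => v (X i)) = stdVol m X • v := by
  ext1 u
  have h := congrArg v (sum_stdVol_update_smul X u)
  simp only [map_sum, map_smul] at h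
  exact (wedgeInterior_apply X _ u).trans h

theorem wedgeInterior_of_eq_zero {X : Fin m → BaseModel m} {i : Fin m} (hX : X i = 0)
    (Y : Fin m → FibModel n) :
    wedgeInterior X Y = ((stdVol m).toContinuousLinearMap X i).smulRight (Y i) := by
  ext1 u
  rw [wedgeInterior_apply, Finset.sum_eq_single i]
  · simp
  · intro k _ hk
    rw [(stdVol m).map_coord_zero i (by simp [hk.symm, hX]), zero_smul]
  · simp

theorem stdVol_cons_removeNth {k : ℕ} (X : Fin (k + 1) → BaseModel (k + 1)) (i : Fin (k + 1))
    (u : BaseModel (k + 1)) :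
    stdVol (k + 1) (Fin.cons u (i.removeNth X)) =
      (-1) ^ i.val * stdVol (k + 1) (update X i u) := by
  have h := (stdVol (k + 1)).neg_one_pow_smul_map_insertNth i u (i.removeNth X)
  rw [Fin.insertNth_removeNth] at h
  simpa [Matrix.vecCons] using h.symm

/-- The value `dy^A - v^A_α dx^α` on `w` of the contact forms at `z = (x, y, v)`. -/
def contact (z w : JetModel m n) : FibModel n := w.1.2 - z.2 w.1.1

theorem wedgeInterior_contact (z : JetModel m n) (W : Fin m → JetModel m n) :
    wedgeInterior (fun k => (W k).1.1) (fun k => contact z (W k)) =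
      wedgeInterior (fun k => (W k).1.1) (fun k => (W k).1.2) -
        stdVol m (fun k => (W k).1.1) • z.2 := by
  rw [← wedgeInterior_comp, ← map_sub]
  rfl

/-- The coordinate expression
`∂ℓ/∂v^A_α (dy^A - v^A_β dx^β) ∧ i(∂/∂x^α) (dx¹ ∧ … ∧ dxᵐ) + ℓ dx¹ ∧ … ∧ dxᵐ`
of the Poincaré–Cartan form of the Lagrangian `ℓ`. -/
def localForm (ℓ : JetModel m n → ℝ) (z : JetModel m n) (W : Fin m → JetModel m n) : ℝ :=
  fderiv ℝ ℓ z (0, wedgeInterior (fun k => (W k).1.1) fun k => contact z (W k)) +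
    ℓ z * stdVol m fun k => (W k).1.1

variable {ℓ : JetModel m n → ℝ} {z : JetModel m n}

theorem localForm_of_eq_zero (W : Fin m → JetModel m n) {i : Fin m} (hW : (W i).1.1 = 0) :
    localForm ℓ z W = fderiv ℝ ℓ z
      (0, ((stdVol m).toContinuousLinearMap (fun k => (W k).1.1) i).smulRight (W i).1.2) := by
  rw [localForm, wedgeInterior_of_eq_zero hW,
    (stdVol m).map_coord_zero (m := fun k => (W k).1.1) i hW]
  simp [contact, hW]

theorem hasFDerivAt_localForm (hℓ : ContDiffAt ℝ 2 ℓ z) (W : Fin m → JetModel m n) :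
    HasFDerivAt (fun y => localForm ℓ y W)
      ((fderiv ℝ (fderiv ℝ ℓ) z).flip
          (0, wedgeInterior (fun k => (W k).1.1) fun k => contact z (W k)) +
        stdVol m (fun k => (W k).1.1) • (fderiv ℝ ℓ z).comp
          ((ContinuousLinearMap.inl ℝ (TotModel m n) (JetFib m n)).comp
            (ContinuousLinearMap.fst ℝ (TotModel m n) (JetFib m n)))) z := by
  set vol := stdVol m (fun k => (W k).1.1)
  have hcontact : HasFDerivAt (fun y : JetModel m n => ((0, wedgeInterior (fun k => (W k).1.1)
      fun k => contact y (W k)) : JetModel m n))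
      (-(vol • (ContinuousLinearMap.inr ℝ (TotModel m n) (JetFib m n)).comp
        (ContinuousLinearMap.snd ℝ (TotModel m n) (JetFib m n)))) z := by
    refine (ContinuousLinearMap.hasFDerivAt _).const_sub
      ((0, wedgeInterior (fun k => (W k).1.1) fun k => (W k).1.2) : JetModel m n)
        |>.congr_of_eventuallyEq (.of_forall fun y => ?_)
    exact Prod.ext (by simp) (wedgeInterior_contact y W)
  have hfderiv : HasFDerivAt (fderiv ℝ ℓ) (fderiv ℝ (fderiv ℝ ℓ) z) z :=
    ((hℓ.fderiv_right (m := 1) le_rfl).differentiableAt (by simp)).hasFDerivAt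
  have hℓ' : HasFDerivAt ℓ (fderiv ℝ ℓ z) z := (hℓ.differentiableAt (by simp)).hasFDerivAt
  refine ((hfderiv.clm_apply hcontact).add (hℓ'.mul_const vol)).congr_fderiv ?_
  refine ContinuousLinearMap.ext fun ζ => ?_
  have hsplit : ζ = (ζ.1, 0) + (0, ζ.2) := by simp
  have hζ : fderiv ℝ ℓ z ζ = fderiv ℝ ℓ z (ζ.1, 0) + fderiv ℝ ℓ z (0, ζ.2) := by
    rw [← map_add, ← hsplit]
  simp only [ContinuousLinearMap.comp_neg, ContinuousLinearMap.comp_smulₛₗ, Real.ringHom_apply,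
    add_apply, neg_apply, smul_apply, ContinuousLinearMap.comp_apply, ContinuousLinearMap.coe_snd',
    ContinuousLinearMap.inr_apply, smul_eq_mul, ContinuousLinearMap.flip_apply, hζ,
    ContinuousLinearMap.coe_fst', ContinuousLinearMap.inl_apply]
  ring

/-- The coordinate expression of the exterior derivative of `localForm ℓ`. -/
def localFormExt (ℓ : JetModel m n → ℝ) (z : JetModel m n) (W : Fin (m + 1) → JetModel m n) : ℝ :=
  ∑ i, (-1) ^ i.val • fderiv ℝ (fun y => localForm ℓ y (i.removeNth W)) z (W i)

theorem localForm_succ_removeNth_cons {ζ : JetModel m n} (hζ : ζ.1.1 = 0)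
    (W : Fin m → JetModel m n) (i : Fin m) :
    localForm ℓ z (i.succ.removeNth (Fin.cons ζ W : Fin (m + 1) → JetModel m n)) =
      (-1) ^ i.val * fderiv ℝ ℓ z
        (0, ((stdVol m).toContinuousLinearMap (fun k => (W k).1.1) i).smulRight ζ.1.2) := by
  obtain _ | k := m
  · exact i.elim0
  have hcons : i.succ.removeNth (Fin.cons ζ W : Fin (k + 1 + 1) → JetModel (k + 1) n) =
      Fin.cons ζ (i.removeNth W) := by
    ext1 l
    refine Fin.cases ?_ (fun l => ?_) l <;> simp [Fin.removeNth]
  have hupdate : ∀ u, update (fun l => (Fin.cons ζ (i.removeNth W) :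
      Fin (k + 1) → JetModel (k + 1) n) l |>.1.1) 0 u =
        Fin.cons u (i.removeNth fun l => (W l).1.1) := by
    intro u
    ext1 l
    refine Fin.cases ?_ (fun l => ?_) l <;> simp [Fin.removeNth]
  have hslot : (stdVol (k + 1)).toContinuousLinearMap (fun l => (Fin.cons ζ (i.removeNth W) :
      Fin (k + 1) → JetModel (k + 1) n) l |>.1.1) 0 =
        (-1 : ℝ) ^ i.val • (stdVol (k + 1)).toContinuousLinearMap (fun l => (W l).1.1) i := by
    ext1 u
    exact (congrArg _ (hupdate u)).trans (stdVol_cons_removeNth _ i u)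
  rw [hcons, localForm_of_eq_zero _ (i := 0) hζ, hslot, ← smul_eq_mul, ← map_smul]
  congr 1
  refine Prod.ext (smul_zero _).symm ?_
  ext1 u
  simp [mul_smul]

theorem localFormExt_cons (hℓ : ContDiffAt ℝ 2 ℓ z) {ζ : JetModel m n} (hζ : ζ.1.1 = 0)
    (W : Fin m → JetModel m n) :
    localFormExt ℓ z (Fin.cons ζ W) =
      fderiv ℝ (fderiv ℝ ℓ) z ζ
          (0, wedgeInterior (fun k => (W k).1.1) fun k => contact z (W k)) +
        stdVol m (fun k => (W k).1.1) * fderiv ℝ ℓ z (ζ.1, 0) -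
        ∑ i, fderiv ℝ (fderiv ℝ ℓ) z (W i)
          (0, ((stdVol m).toContinuousLinearMap (fun k => (W k).1.1) i).smulRight ζ.1.2) := by
  have hzero : (0 : Fin (m + 1)).removeNth (Fin.cons ζ W : Fin (m + 1) → JetModel m n) = W := by
    ext1 i
    simp [Fin.removeNth]
  have hsign : ∀ i : Fin m, (-1 : ℝ) ^ (i.val + 1) * (-1) ^ i.val = -1 := fun i => by
    rw [← pow_add, show i.val + 1 + i.val = 2 * i.val + 1 by ring, pow_succ, pow_mul]
    simp
  have hsucc : ∀ i : Fin m, fderiv ℝ (fun y => localForm ℓ y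
      (i.succ.removeNth (Fin.cons ζ W : Fin (m + 1) → JetModel m n))) z (W i) =
      (-1) ^ i.val * fderiv ℝ (fderiv ℝ ℓ) z (W i)
        (0, ((stdVol m).toContinuousLinearMap (fun k => (W k).1.1) i).smulRight ζ.1.2) := by
    intro i
    simp only [localForm_succ_removeNth_cons hζ W i]
    rw [((hasFDerivAt_fderiv_apply hℓ _).const_mul ((-1 : ℝ) ^ i.val)).fderiv]
    rfl
  rw [localFormExt, Fin.sum_univ_succ, Fin.cons_zero, hzero, (hasFDerivAt_localForm hℓ W).fderiv,
    sub_eq_add_neg, ← Finset.sum_neg_distrib]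
  congr 1
  · simp
  · refine Finset.sum_congr rfl fun i _ => ?_
    rw [Fin.cons_succ, hsucc, zsmul_eq_mul, ← mul_assoc]
    push_cast
    rw [Fin.val_succ, hsign, neg_one_mul]

theorem localFormExt_cons_eq_zero (hℓ : ContDiffAt ℝ 2 ℓ z) {ζ : JetModel m n} (hζ : ζ.1 = 0)
    (hnull : ∀ v : JetFib m n, fderiv ℝ (fderiv ℝ ℓ) z ζ (0, v) = 0) (W : Fin m → JetModel m n) :
    localFormExt ℓ z (Fin.cons ζ W) = 0 := by
  have hslot : ∀ i, ((stdVol m).toContinuousLinearMap (fun k => (W k).1.1) i).smulRight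
      (0 : FibModel n) = 0 := fun i => by
    ext1 u
    simp
  have hzero : ((0, 0) : JetModel m n) = 0 := rfl
  rw [localFormExt_cons hℓ (by rw [hζ]; rfl), hnull, hζ]
  simp [hslot, hzero]

theorem localFormExt_cons_holonomic (hℓ : ContDiffAt ℝ 2 ℓ z) (W : Fin m → JetModel m n)
    (hframe : ∀ i, (W i).1.1 = EuclideanSpace.single i 1) (hcontact : ∀ i, contact z (W i) = 0)
    (b : FibModel n) :
    localFormExt ℓ z (Fin.cons ((0, b), 0) W) = fderiv ℝ ℓ z ((0, b), 0) -
      ∑ i, fderiv ℝ (fderiv ℝ ℓ) z (W i) (0, (EuclideanSpace.proj i).smulRight b) := by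
  have hslot : ∀ i, (stdVol m).toContinuousLinearMap
      (fun k => EuclideanSpace.single k (1 : ℝ)) i = EuclideanSpace.proj i := fun i => by
    ext1 u
    exact stdVol_update_single i u
  have hwedge : wedgeInterior (fun k => (W k).1.1) (fun _ => (0 : FibModel n)) = 0 := map_zero _
  have hzero : ((0, 0) : JetModel m n) = 0 := rfl
  rw [localFormExt_cons hℓ rfl]
  simp only [hcontact, hwedge]
  simp [hzero, hframe, hslot, stdVol_single]

end LocalForm

section Charts

variable {m n : ℕ} {M E : Type*}
  [TopologicalSpace M] [ChartedSpace (BaseModel m) M]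
  [TopologicalSpace E] [ChartedSpace (TotModel m n) E] [IsManifold 𝓘(ℝ, TotModel m n) ∞ E]
  {π : E → M} [hπ : IsFibredManifold m n π]

/-- The chart `(x^α, y^A, v^A_α)` of `J¹π` over an adapted chart. The point `q` only serves as the
value of the inverse outside the target. -/
def jetChart (a : AdaptedChart m n π) (q : Jet m n π) :
    OpenPartialHomeomorph (Jet m n π) (JetModel m n) :=
  ((jetCoords hπ).core hπ).openPartialHomeomorph ((jetCoords hπ).chart a q) ⟨(a, q), rfl⟩

/-- The chart `(x^α, y^A, p^α_A)` of `J¹π*` over an adapted chart. The point `r` only serves as the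
value of the inverse outside the target. -/
def momentumChart (a : AdaptedChart m n π) (r : Momentum m n π) :
    OpenPartialHomeomorph (Momentum m n π) (MomModel m n) :=
  ((momentumCoords hπ).core hπ).openPartialHomeomorph ((momentumCoords hπ).chart a r)
    ⟨(a, r), rfl⟩

variable (a : AdaptedChart m n π) (q : Jet m n π) (r : Momentum m n π)

theorem jetChart_mem_maximalAtlas :
    jetChart a q ∈ IsManifold.maximalAtlas 𝓘(ℝ, JetModel m n) ∞ (Jet m n π) :=
  IsManifold.subset_maximalAtlas (mem_iUnion₂.2 ⟨(jetCoords hπ).chart a q, ⟨(a, q), rfl⟩, rfl⟩)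

theorem momentumChart_mem_maximalAtlas :
    momentumChart a r ∈ IsManifold.maximalAtlas 𝓘(ℝ, MomModel m n) ∞ (Momentum m n π) :=
  IsManifold.subset_maximalAtlas
    (mem_iUnion₂.2 ⟨(momentumCoords hπ).chart a r, ⟨(a, r), rfl⟩, rfl⟩)

theorem jetChart_apply (j : Jet m n π) :
    jetChart a q j = (a.tot j.pt, a.ofTangent j.pt j.hor) := rfl

theorem momentumChart_apply {p : Momentum m n π} (h : p.pt ∈ a.tot.source) :
    momentumChart a r p =
      (a.tot p.pt, LinearMap.toContinuousLinearMap (p.mom ∘ₗ a.toVertHom hπ p.pt h)) :=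
  congrArg (Prod.mk (a.tot p.pt)) (dif_pos h)

theorem mem_jetChart_source {j : Jet m n π} :
    j ∈ (jetChart a q).source ↔ j.pt ∈ a.tot.source := Iff.rfl

theorem mem_momentumChart_source {p : Momentum m n π} :
    p ∈ (momentumChart a r).source ↔ p.pt ∈ a.tot.source := Iff.rfl

theorem mem_jetChart_target {z : JetModel m n} :
    z ∈ (jetChart a q).target ↔ z.1 ∈ a.tot.target :=
  ⟨fun h => h.1, fun h => ⟨h, mem_univ _⟩⟩

theorem jetChart_symm_apply {z : JetModel m n} (h : z.1 ∈ a.tot.target) :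
    (jetChart a q).symm z = (jetCoords hπ).glue a (a.tot.symm z.1) (a.tot.map_target h) z.2 :=
  dif_pos h

theorem exists_chartAt_eq_jetChart (j : Jet m n π) :
    ∃ a : AdaptedChart m n π, j.pt ∈ a.tot.source ∧ chartAt (JetModel m n) j = jetChart a j :=
  ⟨_, (exists_adaptedChart hπ j.pt).choose_spec, rfl⟩

theorem contMDiff_jet_pt :
    ContMDiff 𝓘(ℝ, JetModel m n) 𝓘(ℝ, TotModel m n) ∞ (Jet.pt : Jet m n π → E) := by
  intro j
  obtain ⟨a, ha⟩ := exists_adaptedChart hπ j.pt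
  refine contMDiffAt_of_eventually_chart_eq (jetChart_mem_maximalAtlas a j) a.tot_mem
    (F := Prod.fst) ((mem_jetChart_source a j).2 ha) ?_ contDiffAt_fst
  filter_upwards [(jetChart a j).open_source.mem_nhds ha] with k hk using ⟨hk, rfl⟩

omit [IsManifold 𝓘(ℝ, TotModel m n) ∞ E] hπ in
theorem base_mem_target {z : TotModel m n} (hz : z ∈ a.tot.target) : z.1 ∈ a.base.target := by
  have h := a.base.map_source (a.mapsTo (a.tot.map_target hz))
  rwa [← a.fst_eq _ (a.tot.map_target hz), a.tot.right_inv hz] at h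

theorem fst_jetChart {j : Jet m n π} (hj : j.pt ∈ a.tot.source) :
    (jetChart a q j).1.1 = a.base (π j.pt) := a.fst_eq _ hj

end Charts

section TangentCoordinates

variable {m n : ℕ} {M E : Type*}
  [TopologicalSpace M] [ChartedSpace (BaseModel m) M]
  [TopologicalSpace E] [ChartedSpace (TotModel m n) E] [IsManifold 𝓘(ℝ, TotModel m n) ∞ E]
  {π : E → M} [hπ : IsFibredManifold m n π]
  {a : AdaptedChart m n π} (q : Jet m n π) {j : Jet m n π}

theorem chartDeriv_dpt (hj : j.pt ∈ a.tot.source) (w : TangentSpace 𝓘(ℝ, JetModel m n) j) :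
    chartDeriv a.tot j.pt (j.dpt w) = (chartDeriv (jetChart a q) j w).1 := by
  have h := chartDeriv_comp_mfderiv (jetChart_mem_maximalAtlas a q) a.tot_mem
    (f := (Jet.pt : Jet m n π → E)) (F := Prod.fst) hj hj (.of_forall fun k => rfl)
    (contMDiff_jet_pt.mdifferentiable (by simp) j) differentiableAt_fst
  rw [fderiv_fst] at h
  exact DFunLike.congr_fun h w

omit [IsManifold 𝓘(ℝ, TotModel m n) ∞ E] in
theorem chartDeriv_dproj (hj : j.pt ∈ a.tot.source)
    (w : TangentSpace 𝓘(ℝ, TotModel m n) j.pt) :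
    chartDeriv a.base (π j.pt) (dproj m n π j.pt w) = (chartDeriv a.tot j.pt w).1 :=
  DFunLike.congr_fun (a.chartDeriv_comp_dproj hπ hj) w

theorem chartDeriv_dbase (hj : j.pt ∈ a.tot.source) (v : TangentSpace 𝓘(ℝ, JetModel m n) j) :
    chartDeriv a.base (π j.pt) (j.dbase v) = (chartDeriv (jetChart a q) j v).1.1 := by
  rw [Jet.dbase, ContinuousLinearMap.comp_apply, chartDeriv_dproj hj, chartDeriv_dpt q hj]

theorem chartDeriv_hor (hj : j.pt ∈ a.tot.source)
    (u : TangentSpace 𝓘(ℝ, BaseModel m) (π j.pt)) :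
    chartDeriv a.tot j.pt (j.hor u) =
      (chartDeriv a.base (π j.pt) u, (jetChart a q j).2 (chartDeriv a.base (π j.pt) u)) := by
  refine Prod.ext ?_ ?_
  · rw [← chartDeriv_dproj hj]
    exact congrArg (chartDeriv a.base (π j.pt)) (DFunLike.congr_fun j.dproj_comp_hor u)
  · simp [jetChart_apply, AdaptedChart.ofTangent,
      chartDeriv_isInvertible a.base_mem (a.mapsTo hj)]

theorem chartDeriv_vert_dpt (hj : j.pt ∈ a.tot.source)
    (w : TangentSpace 𝓘(ℝ, JetModel m n) j) :
    chartDeriv a.tot j.pt (j.vert (j.dpt w)) =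
      (0, contact (jetChart a q j) (chartDeriv (jetChart a q) j w)) := by
  have h : chartDeriv a.tot j.pt (j.vert (j.dpt w)) =
      chartDeriv a.tot j.pt (j.dpt w) - chartDeriv a.tot j.pt (j.hor (j.dbase w)) := by
    simp [Jet.vert, Jet.dbase]
  rw [h, chartDeriv_hor q hj, chartDeriv_dbase q hj, chartDeriv_dpt q hj]
  exact Prod.ext (sub_self _) rfl

theorem jetChart_shift (A : VertHom m n π j.pt) :
    jetChart a q (j.shift A) = jetChart a q j + (0, a.ofVertHom j.pt A) := by
  refine Prod.ext (add_zero (a.tot j.pt)).symm ?_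
  ext1 u
  simp [jetChart_apply, Jet.shift, AdaptedChart.ofTangent, AdaptedChart.ofVertHom]

variable {η : BaseForm m M}

theorem volume_apply (hj : j.pt ∈ a.tot.source) (w : Fin m → TangentSpace 𝓘(ℝ, JetModel m n) j) :
    j.volume η w = density η a.base (a.base (π j.pt)) *
      stdVol m fun k => (chartDeriv (jetChart a q) j (w k)).1.1 := by
  simp only [← chartDeriv_dbase q hj]
  exact form_apply_eq_density_mul η a.base_mem (a.mapsTo hj) _

open Function in
theorem vertEndo_apply (w : Fin m → TangentSpace 𝓘(ℝ, JetModel m n) j)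
    (u : TangentSpace 𝓘(ℝ, BaseModel m) (π j.pt)) :
    (j.vertEndo η w).1 u =
      ∑ i, η (π j.pt) (update (fun k => j.dbase (w k)) i u) • j.vert (j.dpt (w i)) := by
  change ((VertHom m n π j.pt).subtype (∑ i, _)) u = _
  rw [map_sum, sum_apply]
  rfl

open Function in
theorem ofVertHom_vertEndo (hj : j.pt ∈ a.tot.source)
    (w : Fin m → TangentSpace 𝓘(ℝ, JetModel m n) j) :
    a.ofVertHom j.pt (j.vertEndo η w) = density η a.base (a.base (π j.pt)) •
      wedgeInterior (fun k => (chartDeriv (jetChart a q) j (w k)).1.1)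
        fun k => contact (jetChart a q j) (chartDeriv (jetChart a q) j (w k)) := by
  ext1 u
  change (chartDeriv a.tot j.pt ((j.vertEndo η w).1
    ((chartDeriv a.base (π j.pt)).inverse u))).2 = density η a.base _ • wedgeInterior _ _ u
  rw [vertEndo_apply, map_sum, Prod.snd_sum, wedgeInterior_apply, Finset.smul_sum]
  refine Finset.sum_congr rfl fun i _ => ?_
  have hupdate : (fun k => chartDeriv a.base (π j.pt) (update (fun k => j.dbase (w k)) i
      ((chartDeriv a.base (π j.pt)).inverse u) k)) =
      update (fun k => (chartDeriv (jetChart a q) j (w k)).1.1) i u := by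
    ext1 k
    obtain rfl | hk := eq_or_ne k i
    · simp [chartDeriv_isInvertible a.base_mem (a.mapsTo hj)]
    · simpa only [update_of_ne hk] using chartDeriv_dbase q hj _
  rw [map_smul, chartDeriv_vert_dpt q hj, form_apply_eq_density_mul η a.base_mem (a.mapsTo hj),
    hupdate, Prod.smul_snd, mul_smul]

end TangentCoordinates

section LocalLagrangian

theorem fderiv_comp_add_linearMap {K G : Type*} [NormedAddCommGroup K] [NormedSpace ℝ K]
    [FiniteDimensional ℝ K] [NormedAddCommGroup G] [NormedSpace ℝ G] (φ : K →ₗ[ℝ] G)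
    {g : G → ℝ} {c : G} (hg : DifferentiableAt ℝ g c) (A : K) :
    fderiv ℝ (fun B => g (c + φ B)) 0 A = fderiv ℝ g c (φ A) := by
  have haffine : HasFDerivAt (fun B => c + φ B) (LinearMap.toContinuousLinearMap φ) 0 :=
    (LinearMap.toContinuousLinearMap φ).hasFDerivAt.const_add c
  have hg' : HasFDerivAt g (fderiv ℝ g c) (c + φ 0) := by simpa using hg.hasFDerivAt
  exact DFunLike.congr_fun (hg'.comp (0 : K) haffine).fderiv A

theorem fderiv_mul_comp_fst_apply {X Y : Type*} [NormedAddCommGroup X] [NormedSpace ℝ X]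
    [NormedAddCommGroup Y] [NormedSpace ℝ Y] {g : X × Y → ℝ} {ρ : X → ℝ} {z : X × Y}
    (hg : DifferentiableAt ℝ g z) (hρ : DifferentiableAt ℝ ρ z.1) (v : Y) :
    fderiv ℝ (fun y => g y * ρ y.1) z (0, v) = fderiv ℝ g z (0, v) * ρ z.1 := by
  have hρ' : HasFDerivAt (fun y : X × Y => ρ y.1) _ z := hρ.hasFDerivAt.comp z hasFDerivAt_fst
  refine (DFunLike.congr_fun (hg.hasFDerivAt.mul hρ').fderiv _).trans ?_
  simp [mul_comm]

variable {m n : ℕ} {M E : Type*}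
  [TopologicalSpace M] [ChartedSpace (BaseModel m) M]
  [TopologicalSpace E] [ChartedSpace (TotModel m n) E] [IsManifold 𝓘(ℝ, TotModel m n) ∞ E]
  {π : E → M} [hπ : IsFibredManifold m n π]
  {a : AdaptedChart m n π} (q : Jet m n π) {j : Jet m n π} {L : Jet m n π → ℝ} {z : JetModel m n}

theorem contDiffAt_comp_jetChart_symm (hL : ContMDiff 𝓘(ℝ, JetModel m n) 𝓘(ℝ, ℝ) ∞ L)
    (hz : z.1 ∈ a.tot.target) : ContDiffAt ℝ ∞ (L ∘ (jetChart a q).symm) z := by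
  have h := hL.comp_contMDiffOn
    (contMDiffOn_symm_of_mem_maximalAtlas (jetChart_mem_maximalAtlas a q))
  exact (contMDiffOn_iff_contDiffOn.1 h).contDiffAt
    ((jetChart a q).open_target.mem_nhds ((mem_jetChart_target a q).2 hz))

/-- `VertHom` as a space of linear maps between the models. Tangent spaces carry no norm, so the
chain rule for `Jet.fibreDeriv` is applied here. -/
def vertHomModel (y : E) : Submodule ℝ (BaseModel m →L[ℝ] TotModel m n) := VertHom m n π y

omit [IsManifold 𝓘(ℝ, TotModel m n) ∞ E] hπ in
theorem fderiv_vertHom_comp_add {y : E} {G : Type*} [NormedAddCommGroup G] [NormedSpace ℝ G]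
    (φ : VertHom m n π y →ₗ[ℝ] G) {g : G → ℝ} {c : G} (hg : DifferentiableAt ℝ g c)
    (A : VertHom m n π y) :
    fderiv ℝ (fun B => g (c + φ B)) 0 A = fderiv ℝ g c (φ A) := by
  let φ' : vertHomModel (m := m) (n := n) (π := π) y →ₗ[ℝ] G :=
    { toFun := fun B => φ B
      map_add' := fun B C => φ.map_add B C
      map_smul' := fun c B => φ.map_smul c B }
  have hchain : ∀ B, _ :=
    fderiv_comp_add_linearMap (K := vertHomModel (m := m) (n := n) (π := π) y) φ' hg
  exact hchain A

theorem fibreDeriv_apply (hL : ContMDiff 𝓘(ℝ, JetModel m n) 𝓘(ℝ, ℝ) ∞ L)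
    (hj : j.pt ∈ a.tot.source) (A : VertHom m n π j.pt) :
    j.fibreDeriv L A =
      fderiv ℝ (L ∘ (jetChart a q).symm) (jetChart a q j) (0, a.ofVertHom j.pt A) := by
  have hd : DifferentiableAt ℝ (L ∘ (jetChart a q).symm) (jetChart a q j) :=
    (contDiffAt_comp_jetChart_symm q hL (a.tot.map_source hj)).differentiableAt (by simp)
  let φ := LinearMap.inr ℝ (TotModel m n) (JetFib m n) ∘ₗ a.ofVertHom j.pt
  have hshift : (fun B => L (j.shift B)) =
      fun B => (L ∘ (jetChart a q).symm) (jetChart a q j + φ B) := by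
    ext B
    have hB : jetChart a q j + φ B = jetChart a q (j.shift B) := (jetChart_shift q B).symm
    rw [hB, Function.comp_apply,
      (jetChart a q).left_inv ((mem_jetChart_source a q (j := j.shift B)).2 hj)]
  rw [Jet.fibreDeriv, hshift]
  exact fderiv_vertHom_comp_add φ hd A

variable {η : BaseForm m M}

theorem localLagrangian_eq (hz : z.1 ∈ a.tot.target) :
    localLagrangian η L a z = (L ∘ (jetChart a q).symm) z * density η a.base z.1.1 := by
  rw [localLagrangian, dif_pos hz, Function.comp_apply, jetChart_symm_apply a q hz]

theorem localLagrangian_eventuallyEq (hz : z.1 ∈ a.tot.target) :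
    localLagrangian η L a =ᶠ[𝓝 z] fun y =>
      (L ∘ (jetChart a q).symm) y * density η a.base y.1.1 := by
  filter_upwards [(jetChart a q).open_target.mem_nhds ((mem_jetChart_target a q).2 hz)] with y hy
    using localLagrangian_eq q hy.1

omit [IsManifold 𝓘(ℝ, TotModel m n) ∞ E] hπ in
theorem contDiffAt_density_comp_fst (hη : IsVolumeForm η) {y : TotModel m n}
    (hy : y ∈ a.tot.target) : ContDiffAt ℝ ∞ (fun y : TotModel m n => density η a.base y.1) y :=
  ((hη.smooth a.base a.base_mem).contDiffAt
    (a.base.open_target.mem_nhds (base_mem_target a hy))).comp y contDiffAt_fst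

theorem contDiffAt_localLagrangian (hη : IsVolumeForm η)
    (hL : ContMDiff 𝓘(ℝ, JetModel m n) 𝓘(ℝ, ℝ) ∞ L) (hz : z.1 ∈ a.tot.target) :
    ContDiffAt ℝ ∞ (localLagrangian η L a) z := by
  let q : Jet m n π := (jetCoords hπ).glue a (a.tot.symm z.1) (a.tot.map_target hz) z.2
  exact ((contDiffAt_comp_jetChart_symm q hL hz).mul
    ((contDiffAt_density_comp_fst hη hz).comp z contDiffAt_fst)).congr_of_eventuallyEq
      (localLagrangian_eventuallyEq q hz)

theorem fderiv_localLagrangian_vertical (hη : IsVolumeForm η)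
    (hL : ContMDiff 𝓘(ℝ, JetModel m n) 𝓘(ℝ, ℝ) ∞ L) (hz : z.1 ∈ a.tot.target)
    (v : JetFib m n) :
    fderiv ℝ (localLagrangian η L a) z (0, v) =
      fderiv ℝ (L ∘ (jetChart a q).symm) z (0, v) * density η a.base z.1.1 := by
  rw [(localLagrangian_eventuallyEq q hz).fderiv_eq]
  exact fderiv_mul_comp_fst_apply
    ((contDiffAt_comp_jetChart_symm q hL hz).differentiableAt (by simp))
    ((contDiffAt_density_comp_fst hη hz).differentiableAt (by simp)) v

theorem fderiv_fderiv_localLagrangian_vertical (hη : IsVolumeForm η)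
    (hL : ContMDiff 𝓘(ℝ, JetModel m n) 𝓘(ℝ, ℝ) ∞ L) (hz : z.1 ∈ a.tot.target)
    (u v : JetFib m n) :
    fderiv ℝ (fderiv ℝ (localLagrangian η L a)) z (0, u) (0, v) =
      fderiv ℝ (fderiv ℝ (L ∘ (jetChart a q).symm)) z (0, u) (0, v) * density η a.base z.1.1 := by
  have hℓ := hasFDerivAt_fderiv_apply
    ((contDiffAt_localLagrangian hη hL hz).of_le ENat.LEInfty.out) (0, v)
  have hg := hasFDerivAt_fderiv_apply
    ((contDiffAt_comp_jetChart_symm q hL hz).of_le ENat.LEInfty.out) (0, v)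
  have hvertical : (fun y => fderiv ℝ (localLagrangian η L a) y (0, v)) =ᶠ[𝓝 z] fun y =>
      fderiv ℝ (L ∘ (jetChart a q).symm) y (0, v) * density η a.base y.1.1 := by
    filter_upwards [(jetChart a q).open_target.mem_nhds ((mem_jetChart_target a q).2 hz)] with y hy
      using fderiv_localLagrangian_vertical q hη hL hy.1 v
  rw [← ContinuousLinearMap.flip_apply, ← hℓ.fderiv, hvertical.fderiv_eq,
    fderiv_mul_comp_fst_apply (ρ := fun y => density η a.base y.1) hg.differentiableAt
      ((contDiffAt_density_comp_fst hη hz).differentiableAt (by simp)), hg.fderiv,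
    ContinuousLinearMap.flip_apply]

end LocalLagrangian

section PoincareCartan

variable {m n : ℕ} {M E : Type*}
  [TopologicalSpace M] [ChartedSpace (BaseModel m) M]
  [TopologicalSpace E] [ChartedSpace (TotModel m n) E] [IsManifold 𝓘(ℝ, TotModel m n) ∞ E]
  {π : E → M} [hπ : IsFibredManifold m n π]
  {a : AdaptedChart m n π} (q : Jet m n π) {j : Jet m n π} {L : Jet m n π → ℝ} {z : JetModel m n}
  {η : BaseForm m M}

theorem poincareCartan_apply (hη : IsVolumeForm η)
    (hL : ContMDiff 𝓘(ℝ, JetModel m n) 𝓘(ℝ, ℝ) ∞ L) (hj : j.pt ∈ a.tot.source)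
    (w : Fin m → TangentSpace 𝓘(ℝ, JetModel m n) j) :
    poincareCartan η L j w = localForm (localLagrangian η L a) (jetChart a q j)
      fun i => chartDeriv (jetChart a q) j (w i) := by
  have hz : (jetChart a q j).1 ∈ a.tot.target := a.tot.map_source hj
  have hdef : poincareCartan η L j w = j.fibreDeriv L (j.vertEndo η w) + L j * j.volume η w := rfl
  rw [hdef, fibreDeriv_apply q hL hj, ofVertHom_vertEndo q hj, volume_apply q hj, localForm,
    fderiv_localLagrangian_vertical q hη hL hz, localLagrangian_eq q hz, Function.comp_apply,
    (jetChart a q).left_inv ((mem_jetChart_source a q).2 hj), fst_jetChart a q hj, mul_assoc,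
    ← smul_zero (density η a.base (a.base (π j.pt))), ← Prod.smul_mk, map_smul, smul_eq_mul,
    smul_zero, mul_comm (density _ _ _) (fderiv _ _ _ _)]

theorem chartForm_poincareCartan (hη : IsVolumeForm η)
    (hL : ContMDiff 𝓘(ℝ, JetModel m n) 𝓘(ℝ, ℝ) ∞ L) (hz : z.1 ∈ a.tot.target)
    (W : Fin m → JetModel m n) :
    chartForm (poincareCartan η L) (jetChart a q) z W = localForm (localLagrangian η L a) z W := by
  have hz' := (mem_jetChart_target a q).2 hz
  have hΘ := poincareCartan_apply q hη hL ((jetChart a q).map_target hz')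
    fun i => mfderiv 𝓘(ℝ, JetModel m n) 𝓘(ℝ, JetModel m n) (jetChart a q).symm z (W i)
  rw [(jetChart a q).right_inv hz'] at hΘ
  refine hΘ.trans (congrArg _ (funext fun i => ?_))
  exact chartDeriv_mfderiv_symm (jetChart_mem_maximalAtlas a q) hz' (W i)

theorem chartForm_poincareCartan_eventuallyEq (hη : IsVolumeForm η)
    (hL : ContMDiff 𝓘(ℝ, JetModel m n) 𝓘(ℝ, ℝ) ∞ L) (hz : z.1 ∈ a.tot.target)
    (W : Fin m → JetModel m n) :
    (fun y => chartForm (poincareCartan η L) (jetChart a q) y W) =ᶠ[𝓝 z]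
      fun y => localForm (localLagrangian η L a) y W := by
  filter_upwards [(jetChart a q).open_target.mem_nhds ((mem_jetChart_target a q).2 hz)] with y hy
    using chartForm_poincareCartan q hη hL hy.1 W

theorem differentiableAt_chartForm_poincareCartan (hη : IsVolumeForm η)
    (hL : ContMDiff 𝓘(ℝ, JetModel m n) 𝓘(ℝ, ℝ) ∞ L) (hz : z.1 ∈ a.tot.target) :
    DifferentiableAt ℝ (chartForm (poincareCartan η L) (jetChart a q)) z :=
  differentiableAt_alternatingForm fun W =>
    (hasFDerivAt_localForm ((contDiffAt_localLagrangian hη hL hz).of_le ENat.LEInfty.out)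
      W).differentiableAt.congr_of_eventuallyEq (chartForm_poincareCartan_eventuallyEq q hη hL hz W)

theorem poincareCartanExt_apply (hη : IsVolumeForm η)
    (hL : ContMDiff 𝓘(ℝ, JetModel m n) 𝓘(ℝ, ℝ) ∞ L) (hj : j.pt ∈ a.tot.source)
    (w : Fin (m + 1) → TangentSpace 𝓘(ℝ, JetModel m n) j) :
    poincareCartanExt η L j w = -localFormExt (localLagrangian η L a) (jetChart a q j)
      fun i => chartDeriv (jetChart a q) j (w i) := by
  have hz : (jetChart a q j).1 ∈ a.tot.target := a.tot.map_source hj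
  obtain ⟨b, hb, hchart⟩ := exists_chartAt_eq_jetChart j
  have hd : DifferentiableAt ℝ (chartForm (poincareCartan η L) (chartAt (JetModel m n) j))
      (chartAt (JetModel m n) j j) :=
    hchart ▸ differentiableAt_chartForm_poincareCartan j hη hL (b.tot.map_source hb)
  rw [poincareCartanExt, extDerivManifold_eq _ (jetChart_mem_maximalAtlas a q)
    ((mem_jetChart_source a q).2 hj) hd]
  change -extDeriv (chartForm (poincareCartan η L) (jetChart a q)) (jetChart a q j)
    (fun i => chartDeriv (jetChart a q) j (w i)) = _
  rw [extDeriv_apply (differentiableAt_chartForm_poincareCartan q hη hL hz), localFormExt]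
  refine congrArg _ (Finset.sum_congr rfl fun i _ => ?_)
  rw [(chartForm_poincareCartan_eventuallyEq q hη hL hz _).fderiv_eq]

end PoincareCartan

section Legendre

variable {m n : ℕ}

/-- The coordinate expression `(x, y, v) ↦ (x, y, ∂L/∂v)` of the Legendre map. -/
def legendreLocal (g : JetModel m n → ℝ) (z : JetModel m n) : MomModel m n :=
  (z.1, (fderiv ℝ g z).comp (ContinuousLinearMap.inr ℝ (TotModel m n) (JetFib m n)))

theorem contDiffAt_legendreLocal {g : JetModel m n → ℝ} {z : JetModel m n}
    (hg : ContDiffAt ℝ ∞ g z) : ContDiffAt ℝ ∞ (legendreLocal g) z :=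
  contDiffAt_fst.prodMk ((hg.fderiv_right (m := ∞) (by simp)).clm_comp contDiffAt_const)

theorem fderiv_legendreLocal {g : JetModel m n → ℝ} {z : JetModel m n} (hg : ContDiffAt ℝ 2 g z)
    (ζ : JetModel m n) :
    fderiv ℝ (legendreLocal g) z ζ = (ζ.1, (fderiv ℝ (fderiv ℝ g) z ζ).comp
      (ContinuousLinearMap.inr ℝ (TotModel m n) (JetFib m n))) := by
  have hg' : HasFDerivAt (fderiv ℝ g) (fderiv ℝ (fderiv ℝ g) z) z :=
    ((hg.fderiv_right (m := 1) le_rfl).differentiableAt one_ne_zero).hasFDerivAt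
  have h : HasFDerivAt (legendreLocal g) _ z := hasFDerivAt_fst.prodMk (hg'.clm_comp
    (hasFDerivAt_const (ContinuousLinearMap.inr ℝ (TotModel m n) (JetFib m n)) z))
  rw [h.fderiv]
  refine Prod.ext rfl ?_
  ext v
  simp

variable {M E : Type*}
  [TopologicalSpace M] [ChartedSpace (BaseModel m) M]
  [TopologicalSpace E] [ChartedSpace (TotModel m n) E] [IsManifold 𝓘(ℝ, TotModel m n) ∞ E]
  {π : E → M} [hπ : IsFibredManifold m n π]
  {a : AdaptedChart m n π} (q : Jet m n π) {j : Jet m n π} {L : Jet m n π → ℝ}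

theorem momentumChart_legendre (r : Momentum m n π)
    (hL : ContMDiff 𝓘(ℝ, JetModel m n) 𝓘(ℝ, ℝ) ∞ L) (hj : j.pt ∈ a.tot.source) :
    momentumChart a r (legendre L j) =
      legendreLocal (L ∘ (jetChart a q).symm) (jetChart a q j) := by
  rw [momentumChart_apply a r (p := legendre L j) hj]
  refine Prod.ext rfl (ContinuousLinearMap.ext fun v => ?_)
  change j.fibreDeriv L (a.toVertHom hπ j.pt hj v) = _
  rw [fibreDeriv_apply q hL hj, a.ofVertHom_toVertHom]
  rfl

theorem contMDiff_legendre (hL : ContMDiff 𝓘(ℝ, JetModel m n) 𝓘(ℝ, ℝ) ∞ L) :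
    ContMDiff 𝓘(ℝ, JetModel m n) 𝓘(ℝ, MomModel m n) ∞ (legendre L) := by
  intro j
  obtain ⟨a, ha⟩ := exists_adaptedChart hπ j.pt
  refine contMDiffAt_of_eventually_chart_eq (jetChart_mem_maximalAtlas a j)
    (momentumChart_mem_maximalAtlas a (legendre L j)) ((mem_jetChart_source a j).2 ha)
    (F := legendreLocal (L ∘ (jetChart a j).symm)) ?_
    (contDiffAt_legendreLocal (contDiffAt_comp_jetChart_symm j hL (a.tot.map_source ha)))
  filter_upwards [(jetChart a j).open_source.mem_nhds ha] with k hk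
    using ⟨hk, momentumChart_legendre j _ hL hk⟩

theorem chartDeriv_dlegendre (r : Momentum m n π)
    (hL : ContMDiff 𝓘(ℝ, JetModel m n) 𝓘(ℝ, ℝ) ∞ L) (hj : j.pt ∈ a.tot.source)
    (w : TangentSpace 𝓘(ℝ, JetModel m n) j) :
    chartDeriv (momentumChart a r) (legendre L j) (dlegendre L j w) =
      ((chartDeriv (jetChart a q) j w).1,
        (fderiv ℝ (fderiv ℝ (L ∘ (jetChart a q).symm)) (jetChart a q j)
          (chartDeriv (jetChart a q) j w)).comp
            (ContinuousLinearMap.inr ℝ (TotModel m n) (JetFib m n))) := by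
  have hg := contDiffAt_comp_jetChart_symm (a := a) (z := jetChart a q j) q hL
    (a.tot.map_source hj)
  have hcomp := chartDeriv_comp_mfderiv (jetChart_mem_maximalAtlas a q)
    (momentumChart_mem_maximalAtlas a r) (f := legendre L)
    (F := legendreLocal (L ∘ (jetChart a q).symm)) ((mem_jetChart_source a q).2 hj)
    ((mem_momentumChart_source a r).2 hj)
    (by
      filter_upwards [(jetChart a q).open_source.mem_nhds ((mem_jetChart_source a q).2 hj)]
        with k hk using momentumChart_legendre q r hL hk)
    ((contMDiff_legendre hL).mdifferentiable (by simp) j)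
    ((contDiffAt_legendreLocal hg).differentiableAt (by simp))
  rw [← fderiv_legendreLocal (hg.of_le ENat.LEInfty.out)]
  exact DFunLike.congr_fun hcomp w

theorem chartDeriv_fst_eq_zero_of_dlegendre_eq_zero
    (hL : ContMDiff 𝓘(ℝ, JetModel m n) 𝓘(ℝ, ℝ) ∞ L) (hj : j.pt ∈ a.tot.source)
    {w : TangentSpace 𝓘(ℝ, JetModel m n) j} (hw : dlegendre L j w = 0) :
    (chartDeriv (jetChart a q) j w).1 = 0 := by
  have h := chartDeriv_dlegendre q (legendre L j) hL hj w
  rw [hw, map_zero] at h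
  exact (congrArg Prod.fst h).symm

theorem fderiv_fderiv_eq_zero_of_dlegendre_eq_zero
    (hL : ContMDiff 𝓘(ℝ, JetModel m n) 𝓘(ℝ, ℝ) ∞ L) (hj : j.pt ∈ a.tot.source)
    {w : TangentSpace 𝓘(ℝ, JetModel m n) j} (hw : dlegendre L j w = 0) (v : JetFib m n) :
    fderiv ℝ (fderiv ℝ (L ∘ (jetChart a q).symm)) (jetChart a q j)
      (chartDeriv (jetChart a q) j w) (0, v) = 0 := by
  have h := chartDeriv_dlegendre q (legendre L j) hL hj w
  rw [hw, map_zero] at h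
  exact (DFunLike.congr_fun (congrArg Prod.snd h) v).symm

theorem dpt_eq_zero_of_dlegendre_eq_zero (hL : ContMDiff 𝓘(ℝ, JetModel m n) 𝓘(ℝ, ℝ) ∞ L)
    {w : TangentSpace 𝓘(ℝ, JetModel m n) j} (hw : dlegendre L j w = 0) : j.dpt w = 0 := by
  obtain ⟨a, ha⟩ := exists_adaptedChart hπ j.pt
  have h := chartDeriv_dpt j ha w
  rw [chartDeriv_fst_eq_zero_of_dlegendre_eq_zero j hL ha hw] at h
  exact (chart_mdifferentiable a.tot_mem).mfderiv_injective ha (h.trans (map_zero _).symm)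

variable {η : BaseForm m M}

theorem poincareCartanExt_cons_eq_zero (hη : IsVolumeForm η)
    (hL : ContMDiff 𝓘(ℝ, JetModel m n) 𝓘(ℝ, ℝ) ∞ L)
    {w : TangentSpace 𝓘(ℝ, JetModel m n) j} (hw : dlegendre L j w = 0)
    (v : Fin m → TangentSpace 𝓘(ℝ, JetModel m n) j) :
    poincareCartanExt η L j (Fin.cons w v) = 0 := by
  obtain ⟨a, ha⟩ := exists_adaptedChart hπ j.pt
  have hz : (jetChart a j j).1 ∈ a.tot.target := a.tot.map_source ha
  have hfst := chartDeriv_fst_eq_zero_of_dlegendre_eq_zero j hL ha hw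
  have hpair : chartDeriv (jetChart a j) j w = (0, (chartDeriv (jetChart a j) j w).2) :=
    Prod.ext hfst rfl
  have hcons : (fun i => chartDeriv (jetChart a j) j (Fin.cons (α := fun _ => _) w v i)) =
      Fin.cons (chartDeriv (jetChart a j) j w) fun i => chartDeriv (jetChart a j) j (v i) :=
    funext (Fin.cases rfl fun _ => rfl)
  rw [poincareCartanExt_apply j hη hL ha, hcons, neg_eq_zero]
  refine localFormExt_cons_eq_zero
    ((contDiffAt_localLagrangian hη hL hz).of_le ENat.LEInfty.out) hfst (fun u => ?_) _
  rw [hpair, fderiv_fderiv_localLagrangian_vertical j hη hL hz, ← hpair,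
    fderiv_fderiv_eq_zero_of_dlegendre_eq_zero j hL ha hw, zero_mul]

theorem poincareCartanExt_eq_zero (hη : IsVolumeForm η)
    (hL : ContMDiff 𝓘(ℝ, JetModel m n) 𝓘(ℝ, ℝ) ∞ L)
    {v : Fin (m + 1) → TangentSpace 𝓘(ℝ, JetModel m n) j} {i : Fin (m + 1)}
    (hv : dlegendre L j (v i) = 0) : poincareCartanExt η L j v = 0 := by
  have hswap : poincareCartanExt η L j (v ∘ Equiv.swap 0 i) = 0 := by
    rw [← Fin.cons_self_tail (v ∘ Equiv.swap 0 i)]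
    exact poincareCartanExt_cons_eq_zero hη hL (by simpa using hv) _
  have hperm := (poincareCartanExt η L j).toAlternatingMap.map_perm v (Equiv.swap 0 i)
  exact (smul_eq_zero_iff_eq _).1 (hperm.symm.trans hswap)

end Legendre

section ExteriorPowers

theorem alternatingMap_congr_mod {ι R W F : Type*} [Finite ι] [Ring R]
    [AddCommGroup W] [Module R W] [AddCommGroup F] [Module R F] (f : W [⋀^ι]→ₗ[R] F)
    (K : Submodule R W) (hf : ∀ v : ι → W, ∀ i, v i ∈ K → f v = 0) {v w : ι → W}
    (hvw : ∀ i, v i - w i ∈ K) : f v = f w := by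
  classical
  have := Fintype.ofFinite ι
  have hexpand := f.toMultilinearMap.map_add_univ w (v - w)
  rw [add_sub_cancel] at hexpand
  refine hexpand.trans ((Finset.sum_eq_single Finset.univ (fun s _ hs => ?_) (by simp)).trans ?_)
  · obtain ⟨i, hi⟩ : ∃ i, i ∉ s := not_forall.1 fun h => hs (Finset.eq_univ_iff_forall.2 h)
    refine hf _ i ?_
    rw [Finset.piecewise_eq_of_notMem _ _ _ hi]
    exact hvw i
  · rw [Finset.piecewise_univ, AlternatingMap.coe_multilinearMap]

theorem exists_comp_comp_eq {𝕜 V W : Type*} [Field 𝕜] [AddCommGroup V] [Module 𝕜 V]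
    [AddCommGroup W] [Module 𝕜 W] (T : V →ₗ[𝕜] W) : ∃ P : W →ₗ[𝕜] V, T ∘ₗ P ∘ₗ T = T := by
  obtain ⟨r, hr⟩ := T.rangeRestrict.exists_rightInverse_of_surjective T.range_rangeRestrict
  obtain ⟨P, hP⟩ := LinearMap.exists_extend r
  refine ⟨P, LinearMap.ext fun v => ?_⟩
  have hPT : P (T v) = r (T.rangeRestrict v) := LinearMap.congr_fun hP (T.rangeRestrict v)
  have hTr := congrArg Subtype.val (LinearMap.congr_fun hr (T.rangeRestrict v))
  rw [LinearMap.comp_apply, LinearMap.comp_apply, hPT]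
  exact hTr

theorem exists_compLinearMap_eq {ι 𝕜 V W F : Type*} [Finite ι] [Field 𝕜] [AddCommGroup V]
    [Module 𝕜 V] [AddCommGroup W] [Module 𝕜 W] [AddCommGroup F] [Module 𝕜 F] (T : V →ₗ[𝕜] W)
    (f : V [⋀^ι]→ₗ[𝕜] F) (hf : ∀ v : ι → V, ∀ i, T (v i) = 0 → f v = 0) :
    ∃ g : W [⋀^ι]→ₗ[𝕜] F, g.compLinearMap T = f := by
  obtain ⟨P, hP⟩ := exists_comp_comp_eq T
  refine ⟨f.compLinearMap P, AlternatingMap.ext fun v => ?_⟩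
  refine alternatingMap_congr_mod f T.ker hf fun i => ?_
  rw [LinearMap.mem_ker, map_sub, sub_eq_zero]
  exact LinearMap.congr_fun hP (v i)

variable {m : ℕ} {V W F : Type*} [AddCommGroup V] [Module ℝ V] [AddCommGroup W] [Module ℝ W]
  [AddCommGroup F] [Module ℝ F]

theorem contract_ιMulti (f : V [⋀^Fin m]→ₗ[ℝ] F) (Y : Fin m → V) :
    contract f (exteriorPower.ιMulti ℝ m Y) = f Y :=
  exteriorPower.alternatingMapLinearEquiv_apply_ιMulti f Y

theorem contract_map (g : W [⋀^Fin m]→ₗ[ℝ] F) (T : V →ₗ[ℝ] W) (X : ⋀[ℝ]^m V) :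
    contract g (exteriorPower.map m T X) = contract (g.compLinearMap T) X := by
  refine LinearMap.congr_fun (f := exteriorPower.alternatingMapLinearEquiv g ∘ₗ
    exteriorPower.map m T) (exteriorPower.linearMap_ext (AlternatingMap.ext fun Y => ?_)) X
  simp [Function.comp_def]

theorem map_map_map_ιMulti {T : V →ₗ[ℝ] W} {A : W →ₗ[ℝ] V} {Y : Fin m → V}
    (h : ∀ i, T (A (T (Y i))) = T (Y i)) :
    exteriorPower.map m T (exteriorPower.map m A
      (exteriorPower.map m T (exteriorPower.ιMulti ℝ m Y))) =
      exteriorPower.map m T (exteriorPower.ιMulti ℝ m Y) := by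
  simp only [exteriorPower.map_apply_ιMulti]
  exact congrArg (exteriorPower.ιMulti ℝ m) (funext h)

theorem contract_eq_of_map_eq {f : V [⋀^Fin m]→ₗ[ℝ] F} {T : V →ₗ[ℝ] W}
    (hf : ∀ v : Fin m → V, ∀ i, T (v i) = 0 → f v = 0) {X Y : ⋀[ℝ]^m V}
    (h : exteriorPower.map m T X = exteriorPower.map m T Y) : contract f X = contract f Y := by
  obtain ⟨g, rfl⟩ := exists_compLinearMap_eq T f hf
  rw [← contract_map, ← contract_map, h]

theorem apply_comp_eq_zero_of_range_map {T : V →ₗ[ℝ] W} {X : ⋀[ℝ]^m W}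
    (hT : LinearMap.range (exteriorPower.map m T) = Submodule.span ℝ {X})
    {f : W [⋀^Fin m]→ₗ[ℝ] F} (hf : contract f X = 0) (t : Fin m → V) :
    f (fun i => T (t i)) = 0 := by
  obtain ⟨c, hc⟩ := Submodule.mem_span_singleton.1
    (hT ▸ LinearMap.mem_range_self (exteriorPower.map m T) (exteriorPower.ιMulti ℝ m t))
  calc f (fun i => T (t i)) = contract f (exteriorPower.map m T (exteriorPower.ιMulti ℝ m t)) := by
        rw [contract_map, contract_ιMulti]; rfl
    _ = c • contract f X := by rw [← hc, contract, map_smul, contract]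
    _ = 0 := by rw [hf, smul_zero]

end ExteriorPowers

section TangentSpaces

variable {V V' X X' : Type*} [NormedAddCommGroup V] [NormedSpace ℝ V]
  [NormedAddCommGroup V'] [NormedSpace ℝ V']
  [TopologicalSpace X] [ChartedSpace V X] [TopologicalSpace X'] [ChartedSpace V' X']
  {f : X → X'} {S : Set X} {x : X}

theorem hasMFDerivWithinAt_unique_of_mem_tangentTo
    {f' f'' : TangentSpace 𝓘(ℝ, V) x →L[ℝ] TangentSpace 𝓘(ℝ, V') (f x)}
    (hf' : HasMFDerivWithinAt 𝓘(ℝ, V) 𝓘(ℝ, V') f S x f')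
    (hf'' : HasMFDerivWithinAt 𝓘(ℝ, V) 𝓘(ℝ, V') f S x f'')
    {v : TangentSpace 𝓘(ℝ, V) x} (hv : v ∈ tangentTo S x) : f' v = f'' v := by
  suffices h : tangentTo S x ≤ LinearMap.eqLocus f'.toLinearMap f''.toLinearMap from h hv
  refine Submodule.span_le.2 ?_
  rintro v ⟨γ, hγ, hγS, hγv⟩
  obtain rfl : γ 0 = x := congrArg Bundle.TotalSpace.proj hγv
  obtain rfl := eq_of_heq (Bundle.TotalSpace.mk.inj hγv).2
  have hγ' := (hγ.mdifferentiableAt (by simp)).hasMFDerivAt.hasMFDerivWithinAt (s := γ ⁻¹' S)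
  exact DFunLike.congr_fun (hasMFDerivAt_unique ((hf'.comp (0 : ℝ) hγ' Subset.rfl).hasMFDerivAt hγS)
    ((hf''.comp (0 : ℝ) hγ' Subset.rfl).hasMFDerivAt hγS)) (1 : ℝ)

theorem mfderiv_mfderivWithin_section_apply {σ : X' → X}
    (hf : MDifferentiable 𝓘(ℝ, V) 𝓘(ℝ, V') f) (hx : x ∈ S)
    (hσ : MDifferentiableWithinAt 𝓘(ℝ, V') 𝓘(ℝ, V) σ (f '' S) (f x))
    (hfσ : ∀ p ∈ f '' S, f (σ p) = p) {v : TangentSpace 𝓘(ℝ, V) x} (hv : v ∈ tangentTo S x) :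
    (mfderiv 𝓘(ℝ, V) 𝓘(ℝ, V') f (σ (f x)) (mfderivWithin 𝓘(ℝ, V') 𝓘(ℝ, V) σ (f '' S) (f x)
      (mfderiv 𝓘(ℝ, V) 𝓘(ℝ, V') f x v)) : V') = mfderiv 𝓘(ℝ, V) 𝓘(ℝ, V') f x v := by
  have hf' := (hf x).hasMFDerivAt.hasMFDerivWithinAt (s := S)
  have hcomp : HasMFDerivWithinAt 𝓘(ℝ, V) 𝓘(ℝ, V') (f ∘ σ ∘ f) S x _ :=
    (hf (σ (f x))).hasMFDerivAt.comp_hasMFDerivWithinAt x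
      (hσ.hasMFDerivWithinAt.comp x hf' (subset_preimage_image f S))
  exact hasMFDerivWithinAt_unique_of_mem_tangentTo (hcomp.congr_mono
    (fun y hy => (hfσ _ (mem_image_of_mem f hy)).symm) (hfσ _ (mem_image_of_mem f hx)).symm
    Subset.rfl) hf' hv

theorem IsFinalIntegrabilitySubmanifold.subset {m : ℕ} [IsManifold 𝓘(ℝ, V) ∞ X]
    {𝒳 : MultiVectorField m V X} {I : Set X} (hI : IsFinalIntegrabilitySubmanifold S 𝒳 I) :
    I ⊆ S := by
  obtain ⟨i, -, rfl⟩ := hI.stable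
  have hanti : Antitone (integrabilitySet S 𝒳) := antitone_nat_of_succ_le fun _ => sep_subset _ _
  exact (hanti i.zero_le).trans (sep_subset _ _)

end TangentSpaces

section Projection

variable {m n : ℕ} {M E : Type*}
  [TopologicalSpace M] [ChartedSpace (BaseModel m) M]
  [TopologicalSpace E] [ChartedSpace (TotModel m n) E] [IsManifold 𝓘(ℝ, TotModel m n) ∞ E]
  {π : E → M} [hπ : IsFibredManifold m n π]
  {j : Jet m n π} {L : Jet m n π → ℝ} {η : BaseForm m M} {N S I : Set (Jet m n π)}
  {σ : Momentum m n π → Jet m n π} {XN XS : MultiVectorField m (JetModel m n) (Jet m n π)}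
  {XP : MultiVectorField m (MomModel m n) (Momentum m n π)}

theorem IsSectionOnto.apply_legendre (hσ : IsSectionOnto L N S σ) (hj : j ∈ S) :
    σ (legendre L j) = j := by
  obtain ⟨p, hp, rfl⟩ := hσ.image_eq.symm ▸ hj
  rw [hσ.legendre_apply p hp]

theorem IsImageUnder.exists_eq_map (hL : ContMDiff 𝓘(ℝ, JetModel m n) 𝓘(ℝ, ℝ) ∞ L)
    (hσ : IsSectionOnto L N S σ) (hXS : IsImageUnder L N σ XP XS) (hj : j ∈ N)
    {k : Jet m n π} (hk : σ (legendre L j) = k) :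
    ∃ A : TangentSpace 𝓘(ℝ, MomModel m n) (legendre L j) →ₗ[ℝ] TangentSpace 𝓘(ℝ, JetModel m n) k,
      XS k = exteriorPower.map m A (XP (legendre L j)) ∧ ∀ v ∈ tangentTo N j,
        (dlegendre L k (A (dlegendre L j v)) : MomModel m n) = dlegendre L j v := by
  subst hk
  have hp : legendre L j ∈ legendre L '' N := mem_image_of_mem _ hj
  exact ⟨_, hXS _ hp, fun v hv => mfderiv_mfderivWithin_section_apply
    ((contMDiff_legendre hL).mdifferentiable (by simp)) hj
    ((hσ.smooth _ hp).mdifferentiableWithinAt (by simp)) hσ.legendre_apply hv⟩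

theorem IsImageUnder.pushforward_eq (hL : ContMDiff 𝓘(ℝ, JetModel m n) 𝓘(ℝ, ℝ) ∞ L)
    (hσ : IsSectionOnto L N S σ) (hXS : IsImageUnder L N σ XP XS) (hjN : j ∈ N) (hjS : j ∈ S)
    {Y : Fin m → TangentSpace 𝓘(ℝ, JetModel m n) j} (hY : ∀ i, Y i ∈ tangentTo N j)
    (hXP : pushforward L j (exteriorPower.ιMulti ℝ m Y) = XP (legendre L j)) :
    pushforward L j (XS j) = pushforward L j (exteriorPower.ιMulti ℝ m Y) := by
  obtain ⟨A, hXSj, hA⟩ := hXS.exists_eq_map hL hσ hjN (hσ.apply_legendre hjS)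
  exact (congrArg (pushforward L j) (hXSj.trans (congrArg _ hXP.symm))).trans
    (map_map_map_ιMulti fun i => hA (Y i) (hY i))

theorem pushforward_eq (hL : ContMDiff 𝓘(ℝ, JetModel m n) 𝓘(ℝ, ℝ) ∞ L)
    (hXN : IsLocallyDecomposableOn N XN) (hXP : IsProjectableOnto L N XN XP)
    (hσ : IsSectionOnto L N S σ) (hXS : IsImageUnder L N σ XP XS) (hjN : j ∈ N) (hjS : j ∈ S) :
    pushforward L j (XS j) = pushforward L j (XN j) := by
  obtain ⟨O, hjO, Z, hZ⟩ := hXN j hjN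
  have hXNj := congrArg (pushforward L j) (hZ.eq_wedge j ⟨hjN, hjO⟩)
  exact (hXS.pushforward_eq hL hσ hjN hjS (hZ.tangent j ⟨hjN, hjO⟩)
    (hXNj.symm.trans (hXP j hjN))).trans hXNj.symm

theorem contract_vertEndo_congr (hL : ContMDiff 𝓘(ℝ, JetModel m n) 𝓘(ℝ, ℝ) ∞ L)
    {X Y : ⋀[ℝ]^m (TangentSpace 𝓘(ℝ, JetModel m n) j)}
    (h : pushforward L j X = pushforward L j Y) :
    contract (j.vertEndo η) X = contract (j.vertEndo η) Y := by
  refine contract_eq_of_map_eq (fun v i hv => ?_) h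
  rw [Jet.vertEndo, AlternatingMap.compLinearMap_apply]
  exact (j.vertForm η).map_coord_zero i (dpt_eq_zero_of_dlegendre_eq_zero hL hv)

theorem contract_poincareCartanExt_congr (hη : IsVolumeForm η)
    (hL : ContMDiff 𝓘(ℝ, JetModel m n) 𝓘(ℝ, ℝ) ∞ L)
    {X Y : ⋀[ℝ]^m (TangentSpace 𝓘(ℝ, JetModel m n) j)}
    (h : pushforward L j X = pushforward L j Y) (w : TangentSpace 𝓘(ℝ, JetModel m n) j) :
    contract ((poincareCartanExt η L j).toAlternatingMap.curryLeft w) X =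
      contract ((poincareCartanExt η L j).toAlternatingMap.curryLeft w) Y :=
  contract_eq_of_map_eq (fun _ i hv => poincareCartanExt_eq_zero hη hL (i := i.succ) hv) h

variable {U : Set M} {s : M → Jet m n π} {x : M}

theorem IsIntegralSection.mono (hs : IsIntegralSection I XS U s) (hIS : I ⊆ S) :
    IsIntegralSection S XS U s where
  smooth := hs.smooth
  isSection := hs.isSection
  mem x hx := hIS (hs.mem x hx)
  tangent := hs.tangent

theorem IsIntegralSection.vertEndo_eq_zero (hL : ContMDiff 𝓘(ℝ, JetModel m n) 𝓘(ℝ, ℝ) ∞ L)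
    (hXN : IsLocallyDecomposableOn N XN) (hXP : IsProjectableOnto L N XN XP)
    (hσ : IsSectionOnto L N (semiHolonomicSet η N XN) σ) (hXS : IsImageUnder L N σ XP XS)
    (hs : IsIntegralSection (semiHolonomicSet η N XN) XS U s) (hx : x ∈ U)
    (t : Fin m → TangentSpace 𝓘(ℝ, BaseModel m) x) :
    (s x).vertEndo η (fun i => mfderiv 𝓘(ℝ, BaseModel m) 𝓘(ℝ, JetModel m n) s x (t i)) = 0 := by
  obtain ⟨hN, hV⟩ := hs.mem x hx
  refine apply_comp_eq_zero_of_range_map (hs.tangent x hx) ?_ t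
  rw [contract_vertEndo_congr hL (pushforward_eq hL hXN hXP hσ hXS hN ⟨hN, hV⟩), hV]

theorem IsIntegralSection.poincareCartanExt_eq_zero (hη : IsVolumeForm η)
    (hL : ContMDiff 𝓘(ℝ, JetModel m n) 𝓘(ℝ, ℝ) ∞ L)
    (hXN : IsSolutionOn η L N XN) (hXP : IsProjectableOnto L N XN XP)
    (hσ : IsSectionOnto L N S σ) (hXS : IsImageUnder L N σ XP XS) (hSN : S ⊆ N)
    (hs : IsIntegralSection S XS U s) (hx : x ∈ U)
    (w : TangentSpace 𝓘(ℝ, JetModel m n) (s x)) (t : Fin m → TangentSpace 𝓘(ℝ, BaseModel m) x) :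
    poincareCartanExt η L (s x) (Fin.cons w fun i =>
      mfderiv 𝓘(ℝ, BaseModel m) 𝓘(ℝ, JetModel m n) s x (t i)) = 0 := by
  have hN := hSN (hs.mem x hx)
  refine apply_comp_eq_zero_of_range_map (hs.tangent x hx)
    (f := (poincareCartanExt η L (s x)).toAlternatingMap.curryLeft w) ?_ t
  rw [contract_poincareCartanExt_congr hη hL
    (pushforward_eq hL hXN.decomposable hXP hσ hXS hN (hs.mem x hx)), hXN.field_eq _ hN]

end Projection

section JetSections

variable {m n : ℕ} {M E : Type*}
  [TopologicalSpace M] [ChartedSpace (BaseModel m) M]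
  [TopologicalSpace E] [ChartedSpace (TotModel m n) E] [IsManifold 𝓘(ℝ, TotModel m n) ∞ E]
  {π : E → M} [hπ : IsFibredManifold m n π]

/-- `s` is a smooth section of `J¹π → M` over the open set `U`. -/
structure IsJetSection (U : Set M) (s : M → Jet m n π) : Prop where
  isOpen : IsOpen U
  smooth : ContMDiffOn 𝓘(ℝ, BaseModel m) 𝓘(ℝ, JetModel m n) ∞ s U
  isSection : ∀ x ∈ U, π (s x).pt = x

/-- The coordinates `x^α` of the points of `U` that `φ` maps into the domain of the adapted chart
`a`. -/
def localDomain (a : AdaptedChart m n π) (U : Set M) (φ : M → E) : Set (BaseModel m) :=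
  a.base.target ∩ a.base.symm ⁻¹' (U ∩ φ ⁻¹' a.tot.source)

/-- The coordinate expression `x ↦ (x, y (x), v (x))` of a section `s` of `J¹π → M`. -/
def localJetSection (a : AdaptedChart m n π) (q : Jet m n π) (s : M → Jet m n π) :
    BaseModel m → JetModel m n :=
  jetChart a q ∘ s ∘ a.base.symm

variable {a : AdaptedChart m n π} (q : Jet m n π) {U : Set M} {s : M → Jet m n π} {x : M}
  {z : BaseModel m}

theorem localJetSection_apply :
    localJetSection a q s z = jetChart a q (s (a.base.symm z)) := rfl

theorem IsJetSection.mdifferentiableAt (hs : IsJetSection U s) (hx : x ∈ U) :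
    MDifferentiableAt 𝓘(ℝ, BaseModel m) 𝓘(ℝ, JetModel m n) s x :=
  (hs.smooth.contMDiffAt (hs.isOpen.mem_nhds hx)).mdifferentiableAt (by simp)

theorem IsJetSection.isOpen_localDomain (hs : IsJetSection U s) :
    IsOpen (localDomain a U fun x => (s x).pt) :=
  a.base.symm.isOpen_inter_preimage ((contMDiff_jet_pt.continuous.comp_continuousOn
    hs.smooth.continuousOn).isOpen_inter_preimage hs.isOpen a.tot.open_source)

theorem IsJetSection.fst_localJetSection (hs : IsJetSection U s)
    (hz : z ∈ localDomain a U fun x => (s x).pt) : (localJetSection a q s z).1.1 = z := by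
  obtain ⟨hz, hzU, hza⟩ := hz
  rw [localJetSection_apply, fst_jetChart a q hza, hs.isSection _ hzU, a.base.right_inv hz]

theorem IsJetSection.differentiableAt_localJetSection (hs : IsJetSection U s)
    (hz : z ∈ localDomain a U fun x => (s x).pt) :
    DifferentiableAt ℝ (localJetSection a q s) z := by
  obtain ⟨hz, hzU, hza⟩ := hz
  have h := differentiableAt_chart_comp a.base_mem (jetChart_mem_maximalAtlas a q)
    (a.base.map_target hz) ((mem_jetChart_source a q).2 hza) (hs.mdifferentiableAt hzU)
  rwa [a.base.right_inv hz] at h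

theorem IsJetSection.chartDeriv_mfderiv (hs : IsJetSection U s)
    (hz : z ∈ localDomain a U fun x => (s x).pt) (v : BaseModel m) :
    chartDeriv (jetChart a q) (s (a.base.symm z))
      (mfderiv 𝓘(ℝ, BaseModel m) 𝓘(ℝ, JetModel m n) s (a.base.symm z)
        (mfderiv 𝓘(ℝ, BaseModel m) 𝓘(ℝ, BaseModel m) a.base.symm z v)) =
      fderiv ℝ (localJetSection a q s) z v := by
  obtain ⟨hz, hzU, hza⟩ := hz
  have h := chartDeriv_mfderiv_apply a.base_mem (jetChart_mem_maximalAtlas a q)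
    (a.base.map_target hz) ((mem_jetChart_source a q).2 hza) (hs.mdifferentiableAt hzU)
    (mfderiv 𝓘(ℝ, BaseModel m) 𝓘(ℝ, BaseModel m) a.base.symm z v)
  rwa [chartDeriv_mfderiv_symm a.base_mem hz, a.base.right_inv hz] at h

theorem IsJetSection.fst_fderiv_localJetSection (hs : IsJetSection U s)
    (hz : z ∈ localDomain a U fun x => (s x).pt) (v : BaseModel m) :
    (fderiv ℝ (localJetSection a q s) z v).1.1 = v := by
  have hfst : (fun y => (localJetSection a q s y).1.1) =ᶠ[𝓝 z] id := by
    filter_upwards [hs.isOpen_localDomain.mem_nhds hz] with y hy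
      using hs.fst_localJetSection q hy
  have hd := (hs.differentiableAt_localJetSection q hz).hasFDerivAt.fst.fst
  exact DFunLike.congr_fun (hd.unique ((hasFDerivAt_id z).congr_of_eventuallyEq hfst)) v

theorem IsJetSection.fderiv_localSection (hs : IsJetSection U s)
    (hz : z ∈ localDomain a U fun x => (s x).pt) (v : BaseModel m) :
    fderiv ℝ (localSection a fun x => (s x).pt) z v =
      (fderiv ℝ (localJetSection a q s) z v).1.2 :=
  DFunLike.congr_fun (hs.differentiableAt_localJetSection q hz).hasFDerivAt.fst.snd.fderiv v

variable {η : BaseForm m M}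

theorem IsJetSection.contact_fderiv_single (hη : IsVolumeForm η) (hs : IsJetSection U s)
    (hz : z ∈ localDomain a U fun x => (s x).pt)
    (hV : ∀ t : Fin m → TangentSpace 𝓘(ℝ, BaseModel m) (a.base.symm z),
      (s (a.base.symm z)).vertEndo η (fun i => mfderiv 𝓘(ℝ, BaseModel m) 𝓘(ℝ, JetModel m n) s
        (a.base.symm z) (t i)) = 0) (i : Fin m) :
    contact (localJetSection a q s z)
      (fderiv ℝ (localJetSection a q s) z (EuclideanSpace.single i 1)) = 0 := by
  have hza : (s (a.base.symm z)).pt ∈ a.tot.source := hz.2.2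
  have hcoord := ofVertHom_vertEndo q hza (η := η) fun i =>
    mfderiv 𝓘(ℝ, BaseModel m) 𝓘(ℝ, JetModel m n) s (a.base.symm z)
      (mfderiv 𝓘(ℝ, BaseModel m) 𝓘(ℝ, BaseModel m) a.base.symm z (EuclideanSpace.single i 1))
  rw [hV, map_zero] at hcoord
  have hdensity := density_ne_zero hη.ne_zero a.base_mem (a.mapsTo hza)
  have hwedge := (smul_eq_zero (M := JetFib m n)).1 hcoord.symm |>.resolve_left hdensity
  have hslot := DFunLike.congr_fun hwedge (EuclideanSpace.single i (1 : ℝ))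
  simp only [hs.chartDeriv_mfderiv q hz, hs.fst_fderiv_localJetSection q hz, wedgeInterior_apply,
    stdVol_update_single] at hslot
  simpa [Pi.single_apply, localJetSection_apply] using hslot

theorem IsJetSection.localJetSection_eq_localProlongation (hη : IsVolumeForm η)
    (hs : IsJetSection U s) (hz : z ∈ localDomain a U fun x => (s x).pt)
    (hV : ∀ t : Fin m → TangentSpace 𝓘(ℝ, BaseModel m) (a.base.symm z),
      (s (a.base.symm z)).vertEndo η (fun i => mfderiv 𝓘(ℝ, BaseModel m) 𝓘(ℝ, JetModel m n) s
        (a.base.symm z) (t i)) = 0) :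
    localJetSection a q s z = localProlongation a (fun x => (s x).pt) z := by
  have hjet : (localJetSection a q s z).2 = fderiv ℝ (localSection a fun x => (s x).pt) z := by
    refine ContinuousLinearMap.coe_injective ((EuclideanSpace.basisFun (Fin m) ℝ).toBasis.ext
      fun i => ?_)
    have hcontact := sub_eq_zero.1 (hs.contact_fderiv_single q hη hz hV i)
    rw [hs.fst_fderiv_localJetSection q hz, ← hs.fderiv_localSection q hz] at hcontact
    simpa using hcontact.symm
  exact Prod.ext (Prod.ext (hs.fst_localJetSection q hz) rfl) hjet

theorem totalSpace_mk_eq_of_chartDeriv_eq {V X : Type*} [NormedAddCommGroup V] [NormedSpace ℝ V]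
    [TopologicalSpace X] [ChartedSpace V X] {e : OpenPartialHomeomorph X V}
    (he : e ∈ IsManifold.maximalAtlas 𝓘(ℝ, V) ∞ X) {x y : X} (hx : x ∈ e.source) (hxy : x = y)
    {v : TangentSpace 𝓘(ℝ, V) x} {w : TangentSpace 𝓘(ℝ, V) y}
    (hvw : chartDeriv e x v = chartDeriv e y w) :
    (⟨x, v⟩ : TangentBundle 𝓘(ℝ, V) X) = ⟨y, w⟩ := by
  subst hxy
  rw [(chart_mdifferentiable he).mfderiv_injective hx hvw]

theorem isJetOf_of_jetChart_eq {j : Jet m n π} {φ : M → E} (hj : j.pt ∈ a.tot.source)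
    (hφj : φ (π j.pt) = j.pt)
    (hφ : MDifferentiableAt 𝓘(ℝ, BaseModel m) 𝓘(ℝ, TotModel m n) φ (π j.pt))
    (hπφ : ∀ᶠ x in 𝓝 (π j.pt), π (φ x) = x)
    (h : jetChart a q j = localProlongation a φ (a.base (π j.pt))) : j.IsJetOf φ := by
  intro u
  have hφa : φ (π j.pt) ∈ a.tot.source := hφj.symm ▸ hj
  have hbase := a.mapsTo hj
  have hd := differentiableAt_chart_comp a.base_mem a.tot_mem hbase hφa hφ
  refine totalSpace_mk_eq_of_chartDeriv_eq a.tot_mem hj hφj.symm ?_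
  rw [chartDeriv_mfderiv_apply a.base_mem a.tot_mem hbase hφa hφ, chartDeriv_hor q hj, h]
  have hfst : (fun y => (a.tot (φ (a.base.symm y))).1) =ᶠ[𝓝 (a.base (π j.pt))] id := by
    have hsymm := a.base.tendsto_symm hbase
    filter_upwards [hsymm.eventually hπφ, a.base.open_target.mem_nhds (a.base.map_source hbase),
      hsymm.eventually (hφ.continuousAt.preimage_mem_nhds (a.tot.open_source.mem_nhds hφa))]
      with y hy hyt hya
    rw [a.fst_eq _ hya, hy, a.base.right_inv hyt, id]
  have hfst' := hd.hasFDerivAt.fst.unique ((hasFDerivAt_id _).congr_of_eventuallyEq hfst)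
  exact Prod.ext (DFunLike.congr_fun hfst' _).symm
    (DFunLike.congr_fun hd.hasFDerivAt.snd.fderiv _)

theorem IsJetSection.isJetOf (hη : IsVolumeForm η) (hs : IsJetSection U s) (hx : x ∈ U)
    (hV : ∀ t : Fin m → TangentSpace 𝓘(ℝ, BaseModel m) x,
      (s x).vertEndo η (fun i => mfderiv 𝓘(ℝ, BaseModel m) 𝓘(ℝ, JetModel m n) s x (t i)) = 0) :
    (s x).IsJetOf fun x => (s x).pt := by
  obtain ⟨a, ha⟩ := exists_adaptedChart hπ (s x).pt
  have hπx := hs.isSection x hx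
  have hxa : x ∈ a.base.source := hπx ▸ a.mapsTo ha
  have hz : a.base x ∈ localDomain a U fun x => (s x).pt := by
    refine ⟨a.base.map_source hxa, ?_⟩
    rw [mem_preimage, a.base.left_inv hxa]
    exact ⟨hx, ha⟩
  have hprol : localJetSection a (s x) s (a.base x) =
      localProlongation a (fun x => (s x).pt) (a.base x) := by
    refine hs.localJetSection_eq_localProlongation (s x) hη hz ?_
    rwa [a.base.left_inv hxa]
  rw [localJetSection_apply, a.base.left_inv hxa] at hprol
  refine isJetOf_of_jetChart_eq (s x) ha ?_ ?_ ?_ ?_ <;> rw [hπx]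
  · exact ((contMDiff_jet_pt.contMDiffAt (x := s x)).mdifferentiableAt (by simp)).comp x
      (hs.mdifferentiableAt hx)
  · exact Filter.eventually_of_mem (hs.isOpen.mem_nhds hx) hs.isSection
  · exact hprol

variable {L : Jet m n π → ℝ}

theorem IsJetSection.fderiv_localLagrangian_eq_sum (hη : IsVolumeForm η)
    (hL : ContMDiff 𝓘(ℝ, JetModel m n) 𝓘(ℝ, ℝ) ∞ L) (hs : IsJetSection U s)
    (hz : z ∈ localDomain a U fun x => (s x).pt)
    (hV : ∀ t : Fin m → TangentSpace 𝓘(ℝ, BaseModel m) (a.base.symm z),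
      (s (a.base.symm z)).vertEndo η (fun i => mfderiv 𝓘(ℝ, BaseModel m) 𝓘(ℝ, JetModel m n) s
        (a.base.symm z) (t i)) = 0)
    (hΩ : ∀ (w : TangentSpace 𝓘(ℝ, JetModel m n) (s (a.base.symm z)))
      (t : Fin m → TangentSpace 𝓘(ℝ, BaseModel m) (a.base.symm z)),
      poincareCartanExt η L (s (a.base.symm z)) (Fin.cons w fun i =>
        mfderiv 𝓘(ℝ, BaseModel m) 𝓘(ℝ, JetModel m n) s (a.base.symm z) (t i)) = 0)
    (b : FibModel n) :
    fderiv ℝ (localLagrangian η L a) (localJetSection a q s z) ((0, b), 0) =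
      ∑ i, fderiv ℝ (fderiv ℝ (localLagrangian η L a)) (localJetSection a q s z)
        (fderiv ℝ (localJetSection a q s) z (EuclideanSpace.single i 1))
        (0, (EuclideanSpace.proj i).smulRight b) := by
  have hza : (s (a.base.symm z)).pt ∈ a.tot.source := hz.2.2
  have hinv := chartDeriv_isInvertible (jetChart_mem_maximalAtlas a q)
    ((mem_jetChart_source a q).2 hza)
  let w := (chartDeriv (jetChart a q) (s (a.base.symm z))).inverse ((0, b), 0)
  let e (i : Fin m) := EuclideanSpace.single i (1 : ℝ)
  have hcoord : (fun i => chartDeriv (jetChart a q) (s (a.base.symm z)) ((Fin.cons w fun i =>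
      mfderiv 𝓘(ℝ, BaseModel m) 𝓘(ℝ, JetModel m n) s (a.base.symm z)
        (mfderiv 𝓘(ℝ, BaseModel m) 𝓘(ℝ, BaseModel m) a.base.symm z (e i)) :
        Fin (m + 1) → TangentSpace 𝓘(ℝ, JetModel m n) (s (a.base.symm z))) i)) =
      Fin.cons ((0, b), 0) fun i => fderiv ℝ (localJetSection a q s) z (e i) := by
    refine funext (Fin.cases ?_ fun i => hs.chartDeriv_mfderiv q hz (e i))
    exact hinv.self_apply_inverse _
  have hℓ : ContDiffAt ℝ 2 (localLagrangian η L a) (localJetSection a q s z) :=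
    (contDiffAt_localLagrangian hη hL (a.tot.map_source hza)).of_le ENat.LEInfty.out
  have hext := hΩ w fun i => mfderiv 𝓘(ℝ, BaseModel m) 𝓘(ℝ, BaseModel m) a.base.symm z (e i)
  rw [poincareCartanExt_apply q hη hL hza, neg_eq_zero, hcoord] at hext
  rw [← sub_eq_zero, ← hext]
  exact (localFormExt_cons_holonomic hℓ _ (fun i => hs.fst_fderiv_localJetSection q hz _)
    (hs.contact_fderiv_single q hη hz hV) b).symm

theorem IsJetSection.solvesEulerLagrange (hη : IsVolumeForm η)
    (hL : ContMDiff 𝓘(ℝ, JetModel m n) 𝓘(ℝ, ℝ) ∞ L) (hs : IsJetSection U s)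
    (hV : ∀ x ∈ U, ∀ t : Fin m → TangentSpace 𝓘(ℝ, BaseModel m) x,
      (s x).vertEndo η (fun i => mfderiv 𝓘(ℝ, BaseModel m) 𝓘(ℝ, JetModel m n) s x (t i)) = 0)
    (hΩ : ∀ x ∈ U, ∀ (w : TangentSpace 𝓘(ℝ, JetModel m n) (s x))
      (t : Fin m → TangentSpace 𝓘(ℝ, BaseModel m) x),
      poincareCartanExt η L (s x) (Fin.cons w fun i =>
        mfderiv 𝓘(ℝ, BaseModel m) 𝓘(ℝ, JetModel m n) s x (t i)) = 0) :
    SolvesEulerLagrange η L U fun x => (s x).pt := by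
  intro a z hz hzU hza A
  have hzD : z ∈ localDomain a U fun x => (s x).pt := ⟨hz, hzU, hza⟩
  let q := s (a.base.symm z)
  have hprol : localProlongation a (fun x => (s x).pt) =ᶠ[𝓝 z] localJetSection a q s := by
    filter_upwards [hs.isOpen_localDomain.mem_nhds hzD] with y hy
      using (hs.localJetSection_eq_localProlongation q hη hy (hV _ hy.2.1)).symm
  have hℓ : ContDiffAt ℝ 2 (localLagrangian η L a) (localJetSection a q s z) :=
    (contDiffAt_localLagrangian hη hL (a.tot.map_source hza)).of_le ENat.LEInfty.out
  rw [hprol.eq_of_nhds, hs.fderiv_localLagrangian_eq_sum q hη hL hzD (hV _ hzU) (hΩ _ hzU)]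
  refine Finset.sum_congr rfl fun α _ => ?_
  let p : JetModel m n := (0, (EuclideanSpace.proj α).smulRight (EuclideanSpace.single A 1))
  have hmomentum := (hasFDerivAt_fderiv_apply hℓ p).comp z
    (hs.differentiableAt_localJetSection q hzD).hasFDerivAt
  have hcongr := hprol.fun_comp fun y => fderiv ℝ (localLagrangian η L a) y p
  exact (DFunLike.congr_fun (hcongr.fderiv_eq.trans hmomentum.fderiv)
    (EuclideanSpace.single α 1)).symm

end JetSections

end

end FieldTheory

theorem mainTheorem6_general {m n : ℕ} {M E : Type*}
    [TopologicalSpace M] [ChartedSpace (BaseModel m) M]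
    [TopologicalSpace E] [ChartedSpace (TotModel m n) E] [IsManifold 𝓘(ℝ, TotModel m n) ∞ E]
    (π : E → M) [IsFibredManifold m n π]
    (η : BaseForm m M) (hη : IsVolumeForm η)
    (L : Jet m n π → ℝ) (hL : ContMDiff 𝓘(ℝ, JetModel m n) 𝓘(ℝ, ℝ) ∞ L)
    (N : Set (Jet m n π))
    (XN : MultiVectorField m (JetModel m n) (Jet m n π)) (hXN : IsSolutionOn η L N XN)
    (XP : MultiVectorField m (MomModel m n) (Momentum m n π)) (hXP : IsProjectableOnto L N XN XP)
    (σ : Momentum m n π → Jet m n π) (hσ : IsSectionOnto L N (semiHolonomicSet η N XN) σ)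
    (XS : MultiVectorField m (JetModel m n) (Jet m n π)) (hXS : IsImageUnder L N σ XP XS)
    (U : Set M) (hU : IsOpen U)
    (s : M → Jet m n π) (hs : IsIntegralSection (semiHolonomicSet η N XN) XS U s) :
    ∃ φ : M → E,
      ContMDiffOn 𝓘(ℝ, BaseModel m) 𝓘(ℝ, TotModel m n) ∞ φ U ∧
      (∀ x ∈ U, π (φ x) = x) ∧
      (∀ x ∈ U, (s x).IsJetOf φ) ∧
      SolvesEulerLagrange η L U φ := by
  have hjet : IsJetSection U s := ⟨hU, hs.smooth, hs.isSection⟩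
  have hV : ∀ x ∈ U, ∀ t : Fin m → TangentSpace 𝓘(ℝ, BaseModel m) x,
      (s x).vertEndo η (fun i => mfderiv 𝓘(ℝ, BaseModel m) 𝓘(ℝ, JetModel m n) s x (t i)) = 0 :=
    fun _ hx => hs.vertEndo_eq_zero hL hXN.decomposable hXP hσ hXS hx
  refine ⟨fun x => (s x).pt, contMDiff_jet_pt.comp_contMDiffOn hs.smooth, hs.isSection,
    fun x hx => hjet.isJetOf hη hx (hV x hx), hjet.solvesEulerLagrange hη hL hV fun x hx => ?_⟩
  exact hs.poincareCartanExt_eq_zero hη hL hXN hXP hσ hXS (sep_subset _ _) hx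

theorem mainTheorem6 {m n : ℕ} (hm : 1 < m) {M E : Type*}
    [TopologicalSpace M] [ChartedSpace (BaseModel m) M] [IsManifold 𝓘(ℝ, BaseModel m) ∞ M]
    [TopologicalSpace E] [ChartedSpace (TotModel m n) E] [IsManifold 𝓘(ℝ, TotModel m n) ∞ E]
    (π : E → M) [IsFibredManifold m n π]
    (η : BaseForm m M) (hη : IsVolumeForm η)
    (L : Jet m n π → ℝ) (hL : ContMDiff 𝓘(ℝ, JetModel m n) 𝓘(ℝ, ℝ) ∞ L)
    (hreg : IsAlmostRegular L)
    (N : Set (Jet m n π)) (hN : IsFinalConstraintSubmanifold η L N)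
    (XN : MultiVectorField m (JetModel m n) (Jet m n π)) (hXN : IsSolutionOn η L N XN)
    (XP : MultiVectorField m (MomModel m n) (Momentum m n π)) (hXP : IsProjectableOnto L N XN XP)
    (σ : Momentum m n π → Jet m n π) (hσ : IsSectionOnto L N (semiHolonomicSet η N XN) σ)
    (XS : MultiVectorField m (JetModel m n) (Jet m n π)) (hXS : IsImageUnder L N σ XP XS)
    (I : Set (Jet m n π))
    (hI : IsFinalIntegrabilitySubmanifold (semiHolonomicSet η N XN) XS I)
    (U : Set M) (hU : IsOpen U)
    (s : M → Jet m n π) (hs : IsIntegralSection I XS U s) :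
    ∃ φ : M → E,
      ContMDiffOn 𝓘(ℝ, BaseModel m) 𝓘(ℝ, TotModel m n) ∞ φ U ∧
      (∀ x ∈ U, π (φ x) = x) ∧
      (∀ x ∈ U, (s x).IsJetOf φ) ∧
      SolvesEulerLagrange η L U φ :=
  mainTheorem6_general π η hη L hL N XN hXN XP hXP σ hσ XS hXS U hU s (hs.mono hI.subset)
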